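/- Let $0\le d\le n$ be integers and let $\Delta(d,n)=\{x\in[0,1]^n : x_1+\dots+x_n=d\}$ be the hypersimplex. A subdivision of the vertex set of a polytope $P$ is a collection $\Sigma$ of nonempty sets of vertices of $P$ (cells), closed under taking faces, whose convex hulls cover $P$ and such that the convex hulls of distinct cells have disjoint relative interiors. It is trivial if it has the whole vertex set as a cell, and it is coarsest if it is nontrivial and refines no nontrivial subdivision other than itself. A $k$-split of $P$ is a coarsest subdivision $\Sigma$ of the vertex set of $P$ that has exactly $k$ maximal cells and a cell of codimension $k-1$ in $P$ that is contained in all maximal cells and is interior, i.e. its convex hull is not contained in the boundary of $P$. The convex hull of this cell is called the common cell $H^\Sigma$. **Proposition.** Let $\Sigma$ be a $k$-split of $\Delta(d,n)$. Then there is a matroid $M$ on $[n]$ such that $H^\Sigma$ is the matroid polytope of $M$, i.e. the convex hull of the characteristic vectors of the bases of $M$; $M$ is a partition matroid, i.e. there are a partition of $[n]$ into parts $C_1,\dots,C_m$ and integers $0\le d_i\le |C_i|$ such that the bases of $M$ are exactly the sets $B\subseteq[n]$ with $|B\cap C_i|=d_i$ for all $i$; $M$ has no loops and no coloops; and $M$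 has exactly $k$ connected components. -/

import Mathlib

open scoped Pointwise

/-! ### Subdivisions of point configurations -/

section Subdivisions

variable {E : Type*} [AddCommGroup E] [Module ℝ E]

/-- `F` is a (nonempty) face of the finite configuration `C`: the set of points of `C` at which
some linear functional attains its maximum over `C`. -/
def IsConfigFace (F C : Set E) : Prop :=
  F.Nonempty ∧ ∃ l : E →ₗ[ℝ] ℝ, F = {x | x ∈ C ∧ ∀ y ∈ C, l y ≤ l x}

/-- `S` refines `T`: every cell of `S` lies in a cell of `T`. -/
def Refines (S T : Set (Set E)) : Prop :=
  ∀ C ∈ S, ∃ D ∈ T, C ⊆ D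

/-- `C` is a maximal cell of `S`. -/
def IsMaximalCell (S : Set (Set E)) (C : Set E) : Prop :=
  Maximal (fun D => D ∈ S) C

variable [TopologicalSpace E]

/-- `S` is a (polyhedral) subdivision of the point configuration `A`: a collection of nonempty
subsets of `A` with the closure, union and intersection properties. The polytope belonging to
`C ∈ S` is `convexHull ℝ C`. -/
structure IsSubdivision (A : Set E) (S : Set (Set E)) : Prop where
  subset : ∀ C ∈ S, C ⊆ A
  nonempty : ∀ C ∈ S, C.Nonempty
  closure : ∀ C ∈ S, ∀ F, IsConfigFace F C → F ∈ S
  union : (⋃ C ∈ S, convexHull ℝ C) = convexHull ℝ A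
  inter : ∀ C ∈ S, ∀ D ∈ S, C ≠ D →
    Disjoint (intrinsicInterior ℝ (convexHull ℝ C)) (intrinsicInterior ℝ (convexHull ℝ D))

/-- `S` is a coarsest subdivision of `A`: it is not the trivial subdivision (the one that has `A`
itself as a cell), and the only nontrivial subdivision of `A` that it refines is `S`. -/
def IsCoarsestSubdivision (A : Set E) (S : Set (Set E)) : Prop :=
  IsSubdivision A S ∧ A ∉ S ∧
    ∀ T : Set (Set E), IsSubdivision A T → A ∉ T → Refines S T → T = S

/-- `H` is a common cell of `S`, for the parameter `k`: a cell of codimension `k - 1` that is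
contained in all maximal cells and is interior, i.e. does not lie in the boundary of the polytope
`convexHull ℝ A`. -/
structure IsCommonCell (A : Set E) (k : ℕ) (S : Set (Set E)) (H : Set E) : Prop where
  mem : H ∈ S
  common : ∀ C, IsMaximalCell S C → H ⊆ C
  codim : Module.finrank ℝ (vectorSpan ℝ H) + k = Module.finrank ℝ (vectorSpan ℝ A) + 1
  interior : ¬ convexHull ℝ H ⊆ intrinsicFrontier ℝ (convexHull ℝ A)

/-- `S` is a `k`-split of the point configuration `A`: a coarsest subdivision with exactly `k`
maximal cells and a common (interior) cell of codimension `k - 1`. -/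
structure IsKSplit (A : Set E) (k : ℕ) (S : Set (Set E)) : Prop where
  coarsest : IsCoarsestSubdivision A S
  card_maximal : {C | IsMaximalCell S C}.encard = k
  exists_common : ∃ H, IsCommonCell A k S H

end Subdivisions

/-! ### Hypersimplices -/

/-- The hypersimplex `Δ(d, n)`: the slice of the cube `[0,1]^n` with `∑ i, x i = d`. -/
def hypersimplex (d n : ℕ) : Set (Fin n → ℝ) :=
  {x | (∀ i, x i ∈ Set.Icc (0 : ℝ) 1) ∧ ∑ i, x i = d}

/-- The point configuration formed by the vertices of `Δ(d, n)`. -/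
def hypersimplexVertices (d n : ℕ) : Set (Fin n → ℝ) :=
  (hypersimplex d n).extremePoints ℝ

/-! ### Matroid polytopes, connected components, partition matroids -/

section Matroids

variable {α : Type*}

/-- The matroid polytope `P(M) ⊆ ℝ^α`: the convex hull of the characteristic vectors of the
bases of `M`. -/
def matroidPolytope (M : Matroid α) : Set (α → ℝ) :=
  convexHull ℝ ((fun B : Set α => B.indicator (fun _ => (1 : ℝ))) '' {B | M.IsBase B})

/-- `S` separates `M`: `P(M) = P(M|S) × P(M|(E \ S))`. The two restrictions have their polytopes
in complementary coordinate subspaces of `ℝ^α`, so that the product is the Minkowski sum. -/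
def IsSeparator (M : Matroid α) (S : Set α) : Prop :=
  S ⊆ M.E ∧
    matroidPolytope M = matroidPolytope (M.restrict S) + matroidPolytope (M.restrict (M.E \ S))

/-- `C` is a connected component of `M`: an inclusion-minimal nonempty separator. -/
def IsConnectedComponent (M : Matroid α) (C : Set α) : Prop :=
  Minimal (fun S : Set α => S.Nonempty ∧ IsSeparator M S) C

/-- `M` is a partition matroid on the finite ground set `α`: there are a partition of `α` and
integers `0 ≤ r C ≤ |C|` for its parts `C` such that the bases of `M` are the sets that meet each
part `C` in exactly `r C` elements. -/
def IsPartitionMatroid [Fintype α] [DecidableEq α] (M : Matroid α) : Prop :=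
  M.E = Set.univ ∧
    ∃ (P : Finpartition (Finset.univ : Finset α)) (r : Finset α → ℕ),
      (∀ C ∈ P.parts, r C ≤ C.card) ∧
      ∀ B : Set α, M.IsBase B ↔ ∀ C ∈ P.parts, (B ∩ (C : Set α)).ncard = r C

end Matroids

/-! Around a relatively interior point `h` of the common cell, the split is a complete fan whose
cones come from the full-dimensional maximal cells. Separating these cells pairwise gives
antisymmetric functionals `D i j`, with cone `i` cut out by `0 ≤ D i j`. Comparing dimensions with
the codimension `k - 1` of the common cell shows that there are `k` cones and that the `D i j`, `j ≠
i`, are independent. The common cell spans the slice of the hypersimplex on which all `D i j`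
vanish.

The heart of the proof is that the unit vectors have at most `k` different value patterns under `D`.
Since the cells are spanned by 0/1 vectors, swapping two coordinates whose unit vectors lie in cone
`i` preserves the part of that cone in the hypersimplex (`swap_mem`). Modulo the common kernel the
swap is a reflection with nonnegative matrix in the basis of rays, so it is trivial or interchanges
two rays up to scaling (`exists_labels`). Each `D i j` is a positive multiple of a difference `g i -
g j` (`exists_potential`). Recording each unit vector by its slacks from the maximal `g` gives an
`ExchangeSystem`; deleting one vector and one label at a time bounds the number of vectors by the
number of labels.

Now group coordinates with equal patterns. The `D i j` depend only on the class sums. There are `k -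
1` independent equations with a nonzero solution, the class sums of `h`; so there are exactly `k`
classes and the solution is unique up to scaling. Hence fixed class sums describe the common face.
They are integers because a vertex lies on the face, and they lie strictly between 0 and the class
size because `0 < h < 1`. This is the polytope of a partition matroid without loops or coloops, and
base exchange inside a part shows that its connected components are the parts. -/

/-! ### A counting lemma for nonnegative vectors with exchange relations -/

section ExchangeSystems

variable {Y Λ : Type*} {a : Y → Λ → ℝ} {Ys : Finset Y} {Ls : Finset Λ}

/-- The vectors `a e` and `a b`, which share the zero `i`, are related by an exchange at the labels
`j` and `l` with ratio `c`. -/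
structure ExchangePair (a : Y → Λ → ℝ) (Ys : Finset Y) (Ls : Finset Λ) (e b : Y) (i j l : Λ)
    (c : ℝ) : Prop where
  memj : j ∈ Ls
  meml : l ∈ Ls
  ji : j ≠ i
  li : l ≠ i
  jl : j ≠ l
  pos : 0 < c
  agree : ∀ s ∈ Ls, s ≠ j → s ≠ l → a e s = a b s
  left : a e j = c * a b l
  right : a b j = c * a e l
  ne : a e j ≠ a b j
  rel : ∀ u ∈ Ys, u ≠ e → u ≠ b → a u j - a u i = c * (a u l - a u i)

theorem ExchangePair.swap_vectors {e b : Y} {i j l : Λ} {c : ℝ}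
    (h : ExchangePair a Ys Ls e b i j l c) : ExchangePair a Ys Ls b e i j l c where
  memj := h.memj
  meml := h.meml
  ji := h.ji
  li := h.li
  jl := h.jl
  pos := h.pos
  agree s hs h1 h2 := (h.agree s hs h1 h2).symm
  left := h.right
  right := h.left
  ne := h.ne.symm
  rel u hu h1 h2 := h.rel u hu h2 h1

theorem ExchangePair.ne_right {e b : Y} {i j l : Λ} {c : ℝ}
    (h : ExchangePair a Ys Ls e b i j l c) : a e l ≠ a b l := by
  intro h'
  exact h.ne (by rw [h.left, h.right, h'])

theorem ExchangePair.swap_labels {e b : Y} {i j l : Λ} {c : ℝ}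
    (h : ExchangePair a Ys Ls e b i j l c) : ExchangePair a Ys Ls e b i l j c⁻¹ where
  memj := h.meml
  meml := h.memj
  ji := h.li
  li := h.ji
  jl := h.jl.symm
  pos := inv_pos.2 h.pos
  agree s hs h1 h2 := h.agree s hs h2 h1
  left := by rw [h.right, inv_mul_cancel_left₀ h.pos.ne']
  right := by rw [h.left, inv_mul_cancel_left₀ h.pos.ne']
  ne := h.ne_right
  rel u hu h1 h2 := by rw [h.rel u hu h1 h2, inv_mul_cancel_left₀ h.pos.ne']

/-- A family of vectors, each with a zero, in which any two vectors with a common zero form an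
exchange pair. -/
structure ExchangeSystem (a : Y → Λ → ℝ) (Ys : Finset Y) (Ls : Finset Λ) : Prop where
  zero : ∀ y ∈ Ys, ∃ i ∈ Ls, a y i = 0
  pair : ∀ e ∈ Ys, ∀ b ∈ Ys, e ≠ b → ∀ i ∈ Ls, a e i = 0 → a b i = 0 →
    ∃ j l c, ExchangePair a Ys Ls e b i j l c

/-- If the ratio of an exchange pair at `(j, l)` is at most one, then no pair of other vectors is
related by an exchange at a label pair containing `j`. -/
theorem ExchangePair.not_of_avoid {e b w w' : Y} {i i' j l x : Λ} {c c' : ℝ} (hi : i ∈ Ls)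
    (h : ExchangePair a Ys Ls e b i j l c) (hc : c ≤ 1) (hw : w ∈ Ys) (hw' : w' ∈ Ys)
    (h1 : w ≠ e) (h2 : w ≠ b) (h3 : w' ≠ e) (h4 : w' ≠ b)
    (h' : ExchangePair a Ys Ls w w' i' j x c') : False := by
  have r := h.rel w hw h1 h2
  have r' := h.rel w' hw' h3 h4
  have p := h'.left
  have p' := h'.right
  have hc' := h'.pos
  have hc0 := h.pos
  have hne := h'.ne_right
  have hne' := h'.ne
  by_cases hxi : x = i
  · subst hxi
    have q := h'.agree l h.meml h.jl.symm h.li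
    -- Only this case needs `c ≤ 1`: it makes the first factor positive.
    have : (1 - c + c') * (a w x - a w' x) = 0 := by
      rw [q] at r; linear_combination p - p' - r + r'
    rcases mul_eq_zero.1 this with h0 | h0
    · linarith
    · exact hne (by linarith)
  · have qi := h'.agree i hi h.ji.symm (Ne.symm hxi)
    by_cases hxl : x = l
    · subst hxl
      have : (c + c') * (a w x - a w' x) = 0 := by
        rw [qi] at r; linear_combination p - p' - r + r'
      rcases mul_eq_zero.1 this with h0 | h0
      · linarith
      · exact hne (by linarith)
    · have ql := h'.agree l h.meml h.jl.symm (Ne.symm hxl)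
      rw [ql, qi] at r
      exact hne' (by linarith)

variable [DecidableEq Y] [DecidableEq Λ]

/-- The induction step of the count. After deleting `e` and `s`, `hz` leaves every vector a zero and
`hp` keeps all exchanges off the deleted label. -/
theorem ExchangeSystem.card_le_of_erase (hS : ExchangeSystem a Ys Ls)
    (IH : ∀ Ls' ⊂ Ls, ∀ Ys' : Finset Y, ExchangeSystem a Ys' Ls' → Ys'.card ≤ Ls'.card)
    {e : Y} {s : Λ} (he : e ∈ Ys) (hs : s ∈ Ls)
    (hz : ∀ w ∈ Ys, w ≠ e → a w s = 0 → ∃ i ∈ Ls, i ≠ s ∧ a w i = 0)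
    (hp : ∀ w ∈ Ys, ∀ w' ∈ Ys, w ≠ e → w' ≠ e → w ≠ w' → ∀ i ∈ Ls, i ≠ s → a w i = 0 →
      a w' i = 0 → ∀ x c, ¬ ExchangePair a Ys Ls w w' i s x c) :
    Ys.card ≤ Ls.card := by
  have key : ExchangeSystem a (Ys.erase e) (Ls.erase s) := by
    constructor
    · intro y hy
      rw [Finset.mem_erase] at hy
      obtain ⟨i, hi, h0⟩ := hS.zero y hy.2
      by_cases his : i = s
      · subst his
        obtain ⟨i', hi', h1, h2⟩ := hz y hy.2 hy.1 h0
        exact ⟨i', Finset.mem_erase.2 ⟨h1, hi'⟩, h2⟩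
      · exact ⟨i, Finset.mem_erase.2 ⟨his, hi⟩, h0⟩
    · intro w hw w' hw' hne i hi h1 h2
      rw [Finset.mem_erase] at hw hw' hi
      obtain ⟨j, l, c, h⟩ := hS.pair w hw.2 w' hw'.2 hne i hi.2 h1 h2
      have hj : j ≠ s := by
        rintro rfl
        exact hp w hw.2 w' hw'.2 hw.1 hw'.1 hne i hi.2 hi.1 h1 h2 _ _ h
      have hl : l ≠ s := by
        rintro rfl
        exact hp w hw.2 w' hw'.2 hw.1 hw'.1 hne i hi.2 hi.1 h1 h2 _ _ h.swap_labels
      exact ⟨j, l, c, Finset.mem_erase.2 ⟨hj, h.memj⟩, Finset.mem_erase.2 ⟨hl, h.meml⟩, h.ji, h.li,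
        h.jl, h.pos, fun t ht => h.agree t (Finset.mem_of_mem_erase ht), h.left, h.right, h.ne,
        fun u hu => h.rel u (Finset.mem_of_mem_erase hu)⟩
  have := IH _ (Finset.erase_ssubset hs) _ key
  rw [Finset.card_erase_of_mem he, Finset.card_erase_of_mem hs] at this
  have := Finset.card_pos.2 ⟨s, hs⟩
  omega

/-- This is the configuration in which a single pair does not show what to delete. The exchange
ratio of `e p` and `e q` at `(s p, s q)` is `t p / t q`, so minimality of `t p` makes both ratios at
most one, and `e p`, `s p` can be deleted. -/
theorem ExchangeSystem.card_le_of_triple (ha : ∀ y s, 0 ≤ a y s) (hS : ExchangeSystem a Ys Ls)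
    (IH : ∀ Ls' ⊂ Ls, ∀ Ys' : Finset Y, ExchangeSystem a Ys' Ls' → Ys'.card ≤ Ls'.card)
    {e : Fin 3 → Y} {s : Fin 3 → Λ} {t : Fin 3 → ℝ} {A B : ℝ} {i : Λ} (hi : i ∈ Ls)
    (he : Function.Injective e) (hs : Function.Injective s) (heY : ∀ p, e p ∈ Ys)
    (hsL : ∀ p, s p ∈ Ls) (hsi : ∀ p, s p ≠ i) (hei : ∀ p, a (e p) i = 0) (ht : ∀ p, 0 < t p)
    (hA : 0 ≤ A) (hAB : A < B) (hdiag : ∀ p, a (e p) (s p) = t p * A)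
    (hoff : ∀ p q, p ≠ q → a (e p) (s q) = t q * B) :
    Ys.card ≤ Ls.card := by
  obtain ⟨p, -, hmin⟩ := Finset.exists_min_image Finset.univ t ⟨0, Finset.mem_univ _⟩
  have hpair : ∀ q, q ≠ p → ∃ c ≤ 1, ExchangePair a Ys Ls (e p) (e q) i (s p) (s q) c := by
    intro q hq
    have hlab : ∃ c, ExchangePair a Ys Ls (e p) (e q) i (s p) (s q) c := by
      obtain ⟨j, l, c, h⟩ := hS.pair _ (heY p) _ (heY q) (he.ne hq.symm) i hi (hei p) (hei q)
      have h1 : s p = j ∨ s p = l := by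
        by_contra! hcon
        have := h.agree _ (hsL p) hcon.1 hcon.2
        rw [hdiag, hoff q p hq] at this
        exact hAB.ne (mul_left_cancel₀ (ht p).ne' this)
      have h2 : s q = j ∨ s q = l := by
        by_contra! hcon
        have := h.agree _ (hsL q) hcon.1 hcon.2
        rw [hdiag, hoff p q hq.symm] at this
        exact hAB.ne' (mul_left_cancel₀ (ht q).ne' this)
      have h3 : s p ≠ s q := hs.ne hq.symm
      rcases h1 with rfl | rfl <;> rcases h2 with h2 | h2
      · exact absurd h2.symm h3
      · exact ⟨c, h2 ▸ h⟩
      · exact ⟨c⁻¹, h2 ▸ h.swap_labels⟩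
      · exact absurd h2.symm h3
    obtain ⟨c, h⟩ := hlab
    refine ⟨c, ?_, h⟩
    have h1 := h.right
    rw [hoff q p hq, hoff p q hq.symm, ← mul_assoc] at h1
    have h2 := mul_right_cancel₀ (hA.trans_lt hAB).ne' h1
    have h3 := hmin q (Finset.mem_univ _)
    have h4 := ht q
    by_contra! hc
    nlinarith
  refine hS.card_le_of_erase IH (heY p) (hsL p) ?_ ?_
  · intro w hw hwp h0
    obtain ⟨q, hq⟩ : ∃ q : Fin 3, q ≠ p := exists_ne p
    by_cases hwq : w = e q
    · exact ⟨i, hi, (hsi p).symm, hwq ▸ hei q⟩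
    · obtain ⟨c, hc, h⟩ := hpair q hq
      refine ⟨s q, hsL q, hs.ne hq, ?_⟩
      have h1 := h.rel w hw hwp hwq
      rw [h0] at h1
      have h2 := ha w i
      have h3 := ha w (s q)
      have h4 := h.pos
      have : c * a w (s q) ≤ 0 := by nlinarith
      nlinarith
  · intro w hw w' hw' hwp hwp' hne i' hi' hi'p h1 h2 x c' hx
    by_cases hcon : ∃ q, q ≠ p ∧ e q ≠ w ∧ e q ≠ w'
    · obtain ⟨q, hq, h3, h4⟩ := hcon
      obtain ⟨c, hc, h⟩ := hpair q hq
      exact h.not_of_avoid hi hc hw hw' hwp h3.symm hwp' h4.symm hx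
    · push Not at hcon
      obtain ⟨q, q', hq, hq', hqq⟩ : ∃ q q' : Fin 3, q ≠ p ∧ q' ≠ p ∧ q ≠ q' := by
        have : ∀ p : Fin 3, ∃ q q' : Fin 3, q ≠ p ∧ q' ≠ p ∧ q ≠ q' := by decide
        exact this p
      have h3 := hcon q hq
      have h4 := hcon q' hq'
      have hv : ∀ r, r ≠ p → a (e r) (s p) = t p * B := fun r hr => hoff r p hr
      by_cases h5 : e q = w
      · have h6 : e q' = w' := h4 fun h => hqq (he (h5.trans h.symm))
        exact hx.ne (by rw [← h5, ← h6, hv q hq, hv q' hq'])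
      · have h6 : e q = w' := h3 h5
        by_cases h7 : e q' = w
        · exact hx.ne (by rw [← h7, ← h6, hv q hq, hv q' hq'])
        · exact hqq (he (h6.trans (h4 h7).symm))

/-- Deleting `e` and `j` can fail only if `b` exchanges with a third vector `u` at `j` and some `x`.
The choices `x = i` and `x = l` are contradictory; any other `x` completes a triple. -/
theorem ExchangeSystem.card_le_of_pair (ha : ∀ y s, 0 ≤ a y s) (hS : ExchangeSystem a Ys Ls)
    (IH : ∀ Ls' ⊂ Ls, ∀ Ys' : Finset Y, ExchangeSystem a Ys' Ls' → Ys'.card ≤ Ls'.card)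
    {e b : Y} {i j l : Λ} {c : ℝ} (he : e ∈ Ys) (hb : b ∈ Ys) (hi : i ∈ Ls)
    (hei : a e i = 0) (hbi : a b i = 0) (hc : c ≤ 1) (hlt : a e l < a b l)
    (h : ExchangePair a Ys Ls e b i j l c) : Ys.card ≤ Ls.card := by
  have hc0 := h.pos
  have hA := ha e l
  have hB : 0 < a b l := hA.trans_lt hlt
  have heb : e ≠ b := by
    rintro rfl
    exact hlt.false
  by_cases hcon : ∃ u ∈ Ys, u ≠ e ∧ u ≠ b ∧ ∃ i' ∈ Ls, i' ≠ j ∧ a b i' = 0 ∧ a u i' = 0 ∧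
      ∃ x c', ExchangePair a Ys Ls b u i' j x c'
  · obtain ⟨u, hu, hue, hub, i', hi', hi'j, hbi', hui', x, c', h'⟩ := hcon
    have hr := h.rel u hu hue hub
    have hl := h.left
    have hr2 := h.right
    have hl' := h'.left
    have hr' := h'.right
    have hc'0 := h'.pos
    by_cases hxi : x = i
    · subst hxi
      have h1 := h'.agree l h.meml h.jl.symm h.li
      rw [← h1, hr', hbi] at hr
      have h2 := ha u x
      have h3 := mul_pos hc0 hB
      nlinarith
    have h0 : a u i = 0 := (h'.agree i hi h.ji.symm (Ne.symm hxi)).symm.trans hbi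
    -- For `x = l`, the relations give `c * a b l = c' * a e l`, `c * a e l = c' * a u l` and `c * a
    -- u l = c' * a b l`. The first forces `c < c'`, the second then `a u l < a e l < a b l`,
    -- contrary to the third.
    by_cases hxl : x = l
    · subst hxl
      have h1 := h'.rel e he heb hue.symm
      rw [h.agree i' hi' hi'j h'.li.symm, hbi', hl] at h1
      rw [h0, hr'] at hr
      rw [hr2] at hl'
      simp only [sub_zero] at h1 hr
      have hApos : 0 < a e x := by
        rcases hA.eq_or_lt with h5 | h5
        · rw [← h5] at h1
          have := mul_pos hc0 hB
          linarith
        · exact h5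
      have h2 : c < c' := by
        by_contra! h5
        nlinarith
      have hu0 := ha u x
      have h3 : a u x < a e x := by
        by_contra! h5
        nlinarith
      nlinarith
    · have h1 : a b l = a u l := h'.agree l h.meml h.jl.symm (Ne.symm hxl)
      rw [h0, sub_zero, sub_zero, ← h1] at hr
      have h2 : a e x = a b x := h.agree x h'.meml h'.jl.symm hxl
      have hbx : a b x = c / c' * a b l := by
        rw [hr] at hr'
        field_simp
        linarith
      have hux : a u x = c / c' * a e l := by
        rw [hr2] at hl'
        field_simp
        linarith
      refine hS.card_le_of_triple ha IH (e := ![e, b, u]) (s := ![l, j, x]) (t := ![1, c, c / c'])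
        (A := a e l) (B := a b l) hi ?_ ?_ ?_ ?_ ?_ ?_ ?_ hA hlt ?_ ?_
      · intro p q
        fin_cases p <;> fin_cases q <;> simp [heb, heb.symm, hue, hue.symm, hub, hub.symm]
      · intro p q
        fin_cases p <;> fin_cases q <;>
          simp [h.jl, h.jl.symm, hxl, Ne.symm hxl, h'.jl, h'.jl.symm]
      · intro p; fin_cases p <;> simp [he, hb, hu]
      · intro p; fin_cases p <;> simp [h.memj, h.meml, h'.meml]
      · intro p; fin_cases p <;> simp [h.ji, h.li, hxi]
      · intro p; fin_cases p <;> simp [hei, hbi, h0]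
      · intro p; fin_cases p <;> simp [hc0, div_pos hc0 hc'0]
      · intro p; fin_cases p <;> simp [hr2, hux]
      · intro p q
        fin_cases p <;> fin_cases q <;> simp [hl, h2, hbx, hr, ← h1]
  · refine hS.card_le_of_erase IH he h.memj ?_ ?_
    · intro w hw hwe h0
      by_cases hwb : w = b
      · exact ⟨i, hi, h.ji.symm, hwb ▸ hbi⟩
      · refine ⟨l, h.meml, h.jl.symm, ?_⟩
        have h1 := h.rel w hw hwe hwb
        rw [h0] at h1
        have h2 := ha w i
        have h3 := ha w l
        have : c * a w l ≤ 0 := by nlinarith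
        nlinarith
    · intro w hw w' hw' hwe hwe' hne i' hi' hi'j h1 h2 x c' hx
      by_cases hwb : w = b
      · subst hwb
        exact hcon ⟨w', hw', hwe', hne.symm, i', hi', hi'j, h1, h2, x, c', hx⟩
      by_cases hwb' : w' = b
      · subst hwb'
        exact hcon ⟨w, hw, hwe, hne, i', hi', hi'j, h2, h1, x, c', hx.swap_vectors⟩
      exact h.not_of_avoid hi hc hw hw' hwe hwb hwe' hwb' hx

/-- An exchange system of nonnegative vectors has at most as many vectors as labels. -/
theorem ExchangeSystem.card_le (ha : ∀ y s, 0 ≤ a y s) (hS : ExchangeSystem a Ys Ls) :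
    Ys.card ≤ Ls.card := by
  induction Ls using Finset.strongInduction generalizing Ys with
  | H Ls ih =>
    have IH : ∀ Ls' ⊂ Ls, ∀ Ys' : Finset Y, ExchangeSystem a Ys' Ls' → Ys'.card ≤ Ls'.card :=
      fun Ls' h Ys' h' => ih Ls' h h'
    by_cases hcon : ∃ e ∈ Ys, ∃ b ∈ Ys, e ≠ b ∧ ∃ i ∈ Ls, a e i = 0 ∧ a b i = 0
    · obtain ⟨e, he, b, hb, hne, i, hi, hei, hbi⟩ := hcon
      obtain ⟨j, l, c, h⟩ := hS.pair e he b hb hne i hi hei hbi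
      -- Swapping the labels inverts the ratio, and swapping the vectors reverses the strict
      -- inequality at `l`.
      wlog hc : c ≤ 1 generalizing j l c
      · exact this l j c⁻¹ h.swap_labels (inv_le_one_of_one_le₀ (not_le.1 hc).le)
      rcases lt_or_gt_of_ne h.ne_right with hlt | hlt
      · exact hS.card_le_of_pair ha IH he hb hi hei hbi hc hlt h
      · exact hS.card_le_of_pair ha IH hb he hi hbi hei hc hlt h.swap_vectors
    · push Not at hcon
      have hz := hS.zero
      rcases Ys.eq_empty_or_nonempty with rfl | ⟨y0, hy0⟩
      · simp
      have : Nonempty Λ := ⟨(hz y0 hy0).choose⟩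
      choose! z hz hz0 using hz
      refine Finset.card_le_card_of_injOn z hz ?_
      intro e he b hb heb
      by_contra hne
      exact hcon e he b hb hne (z e) (hz e he) (hz0 e he) (heb ▸ hz0 b hb)

end ExchangeSystems

/-! ### Complete simplicial fans with pairwise separating functionals -/

section Fans

variable {ι V : Type*} [AddCommGroup V] [Module ℝ V] {D : ι → ι → V →ₗ[ℝ] ℝ}

theorem nonneg_of_forall_pos_nonneg_add_mul {x y : ℝ} (h : ∀ ε > 0, 0 ≤ x + ε * y) : 0 ≤ x := by
  by_contra! hx
  have hy : 0 < |y| + 1 := by positivity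
  have h1 := h (-x / (2 * (|y| + 1))) (div_pos (by linarith) (by linarith))
  have h2 : -x / (2 * (|y| + 1)) * y ≤ -x / 2 := by
    rw [div_mul_eq_mul_div, div_le_div_iff₀ (by linarith) (by norm_num)]
    have := le_abs_self y
    nlinarith
  linarith

/-- The cones `{v | ∀ j, 0 ≤ D i j v}` cover the space, and the functionals `D i j`, `j ≠ i`, are
linearly independent for each `i`. -/
structure IsSimplicialFan (D : ι → ι → V →ₗ[ℝ] ℝ) : Prop where
  anti : ∀ i j v, D i j v = -D j i v
  cover : ∀ v, ∃ i, ∀ j, 0 ≤ D i j v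
  surj : ∀ i (r : ι → ℝ), ∃ v, ∀ j, j ≠ i → D i j v = r j

namespace IsSimplicialFan

theorem self (hD : IsSimplicialFan D) (i : ι) (v : V) : D i i v = 0 := by
  linarith [hD.anti i i v]

/-- Push `v` slightly across the wall `D i j = 0` while increasing every other `D i m`. The covering
cone can then be neither `i` nor any cone besides `j`; let the push tend to zero. -/
theorem facet (hD : IsSimplicialFan D) {i j : ι} {v : V} (h0 : D i j v = 0)
    (h : ∀ m, 0 ≤ D i m v) (m : ι) : 0 ≤ D j m v := by
  classical
  by_cases hij : i = j
  · exact hij ▸ h m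
  obtain ⟨z, hz⟩ := hD.surj i (fun m => if m = j then -1 else 1)
  refine nonneg_of_forall_pos_nonneg_add_mul (y := D j m z) fun ε hε => ?_
  obtain ⟨l, hl⟩ := hD.cover (v + ε • z)
  simp only [map_add, map_smul, smul_eq_mul] at hl
  by_cases hlj : l = j
  · exact hlj ▸ hl m
  by_cases hli : l = i
  · subst hli
    have h1 := hl j
    rw [h0, hz j (Ne.symm hij), if_pos rfl] at h1
    linarith
  · have h1 := hl i
    rw [hD.anti l i, hD.anti l i, hz l hli, if_neg hlj] at h1
    linarith [h l]

/-- For `v` in cone `o`, `facet` puts it in cones `j` and `m`, so `D j m v` has both signs. A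
general `v` is a difference of two vectors of cone `o`, obtained from positive parts. -/
theorem eq_zero_of_two (hD : IsSimplicialFan D) {o j m : ι} {v : V} (hj : D o j v = 0)
    (hm : D o m v = 0) : D j m v = 0 := by
  have key : ∀ w, (∀ l, 0 ≤ D o l w) → D o j w = 0 → D o m w = 0 → D j m w = 0 := by
    intro w h1 h2 h3
    have h4 := hD.facet h2 h1 m
    have h5 := hD.facet h3 h1 j
    rw [hD.anti] at h5
    linarith
  obtain ⟨p, hp⟩ := hD.surj o (fun l => max (D o l v) 0)
  have hp' : ∀ l, D o l p = max (D o l v) 0 := by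
    intro l
    by_cases hl : l = o
    · subst hl
      simp [hD.self]
    · exact hp l hl
  have h1 := key p (fun l => by rw [hp']; exact le_max_right _ _) (by simp [hp', hj])
    (by simp [hp', hm])
  have h2 := key (p - v) (fun l => by rw [map_sub, hp']; linarith [le_max_left (D o l v) 0])
    (by simp [hp', hj]) (by simp [hp', hm])
  rw [map_sub, h1] at h2
  linarith

/-- By `eq_zero_of_two`, `D j m` is a combination of `D o j` and `D o m`. The weak signs come from
`facet`; a zero coefficient would contradict independence at `m` or at `j`. -/
theorem exists_coeff (hD : IsSimplicialFan D) {o j m : ι} (hj : j ≠ o) (hm : m ≠ o) (hjm : j ≠ m) :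
    ∃ α β : ℝ, α < 0 ∧ 0 < β ∧ ∀ v, D j m v = α * D o j v + β * D o m v := by
  classical
  obtain ⟨x, hx⟩ := hD.surj o (fun l => if l = j then 1 else 0)
  obtain ⟨y, hy⟩ := hD.surj o (fun l => if l = m then 1 else 0)
  have hxj : D o j x = 1 := by simp [hx j hj]
  have hxm : D o m x = 0 := by simp [hx m hm, hjm.symm]
  have hyj : D o j y = 0 := by simp [hy j hj, hjm]
  have hym : D o m y = 1 := by simp [hy m hm]
  have hx0 : ∀ l, 0 ≤ D o l x := by
    intro l
    by_cases hl : l = o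
    · subst hl; simp [hD.self]
    · rw [hx l hl]; split_ifs <;> norm_num
  have hy0 : ∀ l, 0 ≤ D o l y := by
    intro l
    by_cases hl : l = o
    · subst hl; simp [hD.self]
    · rw [hy l hl]; split_ifs <;> norm_num
  have heq : ∀ v, D j m v = D j m x * D o j v + D j m y * D o m v := by
    intro v
    have := hD.eq_zero_of_two (o := o) (j := j) (m := m) (v := v - D o j v • x - D o m v • y)
      (by simp [hxj, hyj]) (by simp [hxm, hym])
    simp only [map_sub, map_smul, smul_eq_mul] at this
    linarith
  have hx1 : D j m x ≤ 0 := by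
    have := hD.facet hxm hx0 j
    rw [hD.anti] at this
    linarith
  have hy1 : 0 ≤ D j m y := hD.facet hyj hy0 m
  refine ⟨D j m x, D j m y, lt_of_le_of_ne hx1 ?_, lt_of_le_of_ne hy1 ?_, heq⟩
  · intro h0
    obtain ⟨w, hw⟩ := hD.surj m (fun l => if l = j then 1 else 0)
    have h1 := hw j hjm
    have h2 := hw o hm.symm
    rw [if_pos rfl] at h1
    rw [if_neg hj.symm] at h2
    have h3 := heq w
    rw [h0, hD.anti o m, h2, hD.anti, h1] at h3
    norm_num at h3
  · intro h0
    obtain ⟨w, hw⟩ := hD.surj j (fun l => if l = m then 1 else 0)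
    have h1 := hw m hjm.symm
    have h2 := hw o hj.symm
    rw [if_pos rfl] at h1
    rw [if_neg hm.symm] at h2
    have h3 := heq w
    rw [← h0, hD.anti o j, h2, h1] at h3
    norm_num at h3

/-- The functionals of a simplicial fan are, up to positive factors, the differences of one family
of functionals. -/
theorem exists_potential (hD : IsSimplicialFan D) :
    ∃ g : ι → V →ₗ[ℝ] ℝ, ∀ i j, ∃ c > 0, ∀ v, D i j v = c * (g i v - g j v) := by
  classical
  obtain ⟨o, -⟩ := hD.cover 0
  by_cases hex : ∃ p, p ≠ o
  swap
  · push Not at hex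
    exact ⟨fun _ => 0, fun i j => ⟨1, one_pos, fun v => by rw [hex i, hex j, hD.self]; simp⟩⟩
  obtain ⟨p, hp⟩ := hex
  -- `w` spans the ray of cone `p` off the wall to `o`. All `D m l` with `m, l ≠ o` vanish on it and
  -- all `D o m` are negative, so dividing `D o m` by its value at `w` fixes compatible scales.
  obtain ⟨w, hw⟩ := hD.surj p (fun l => if l = o then 1 else 0)
  have hpo : D p o w = 1 := by simp [hw o hp.symm]
  have hpm : ∀ m, m ≠ o → D p m w = 0 := by
    intro m hm
    by_cases hmp : m = p
    · subst hmp; exact hD.self _ _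
    · simp [hw m hmp, hm]
  have hpn : ∀ m, 0 ≤ D p m w := by
    intro m
    by_cases hm : m = o
    · rw [hm, hpo]; norm_num
    · rw [hpm m hm]
  have hml : ∀ m l, m ≠ o → l ≠ o → D m l w = 0 := by
    intro m l hm hl
    have h1 := hD.facet (hpm m hm) hpn l
    have h2 := hD.facet (hpm l hl) hpn m
    rw [hD.anti] at h2
    linarith
  have ht : ∀ m, m ≠ o → D o m w < 0 := by
    intro m hm
    by_cases hmp : m = p
    · rw [hD.anti, hmp, hpo]; norm_num
    · obtain ⟨α, β, hα, hβ, h⟩ := hD.exists_coeff hp hm (Ne.symm hmp)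
      have h1 := h w
      rw [hpm m hm, hD.anti o p, hpo] at h1
      by_contra! h2
      nlinarith
  refine ⟨fun m => if m = o then 0 else (D o m w)⁻¹ • D o m, fun i j => ?_⟩
  by_cases hij : i = j
  · subst hij
    exact ⟨1, one_pos, fun v => by rw [hD.self]; simp⟩
  by_cases hi : i = o
  · subst hi
    have h1 := ht j (Ne.symm hij)
    refine ⟨-D i j w, by linarith, fun v => ?_⟩
    simp only [if_true, if_neg (Ne.symm hij), LinearMap.zero_apply, LinearMap.smul_apply,
      smul_eq_mul]
    field_simp [h1.ne]
    ring
  by_cases hj : j = o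
  · subst hj
    have h1 := ht i hij
    refine ⟨-D j i w, by linarith, fun v => ?_⟩
    simp only [if_true, if_neg hij, LinearMap.zero_apply, LinearMap.smul_apply,
      smul_eq_mul]
    rw [hD.anti]
    field_simp [h1.ne]
    ring
  · obtain ⟨α, β, hα, hβ, h⟩ := hD.exists_coeff hi hj hij
    have h1 := ht i hi
    have h2 := ht j hj
    have h3 := h w
    rw [hml i j hi hj] at h3
    refine ⟨α * D o i w, mul_pos_of_neg_of_neg hα h1, fun v => ?_⟩
    have h4 : α * D o i w = -(β * D o j w) := by linarith
    simp only [if_neg hi, if_neg hj, LinearMap.smul_apply, smul_eq_mul]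
    rw [h v, mul_sub]
    nth_rw 2 [h4]
    field_simp [h1.ne, h2.ne]
    ring

end IsSimplicialFan

end Fans

/-! ### Relative interiors and faces -/

section RelativeInterior

variable {E : Type*} [NormedAddCommGroup E] [NormedSpace ℝ E]

theorem eventually_add_smul_mem_of_mem_intrinsicInterior {Q : Set E} {h v : E}
    (hh : h ∈ intrinsicInterior ℝ Q) (hv : v ∈ vectorSpan ℝ Q) :
    ∀ᶠ t : ℝ in nhds 0, h + t • v ∈ Q := by
  obtain ⟨y, hy, rfl⟩ := mem_intrinsicInterior.1 hh
  have hmem : ∀ t : ℝ, (y : E) + t • v ∈ affineSpan ℝ Q := fun t => by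
    have := AffineSubspace.vadd_mem_of_mem_direction (s := affineSpan ℝ Q) (v := t • v)
      (by rw [direction_affineSpan]; exact Submodule.smul_mem _ _ hv) y.2
    rwa [vadd_eq_add, add_comm] at this
  let f : ℝ → affineSpan ℝ Q := fun t => ⟨(y : E) + t • v, hmem t⟩
  have hf : Continuous f := by
    refine Continuous.subtype_mk ?_ _
    fun_prop
  have hf0 : f 0 = y := Subtype.ext (by simp [f])
  have h1 : f ⁻¹' interior ((↑) ⁻¹' Q) ∈ nhds (0 : ℝ) :=
    (isOpen_interior.preimage hf).mem_nhds (by rw [Set.mem_preimage, hf0]; exact hy)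
  filter_upwards [h1] with t ht
  have h2 : f t ∈ ((↑) ⁻¹' Q : Set (affineSpan ℝ Q)) := interior_subset ht
  exact h2

theorem exists_pos_of_eventually_nhds_zero {p : ℝ → Prop} (h : ∀ᶠ t in nhds 0, p t) :
    ∃ t > 0, p t ∧ p (-t) := by
  obtain ⟨ε, hε, h⟩ := Metric.eventually_nhds_iff.1 h
  refine ⟨ε / 2, by linarith, h ?_, h ?_⟩ <;> simp [abs_of_pos hε, hε]

/-- From `h` one can move a little away from `x` inside `Q`; if `l x < l h`, this would raise `l`
above its maximum. -/
theorem eq_of_mem_intrinsicInterior_of_le {Q : Set E} {h x : E} (hh : h ∈ intrinsicInterior ℝ Q)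
    (l : E →ₗ[ℝ] ℝ) (hl : ∀ y ∈ Q, l y ≤ l h) (hx : x ∈ Q) : l x = l h := by
  have hv : h - x ∈ vectorSpan ℝ Q :=
    vsub_mem_vectorSpan ℝ (intrinsicInterior_subset hh) hx
  obtain ⟨t, ht, h1, -⟩ := exists_pos_of_eventually_nhds_zero
    (eventually_add_smul_mem_of_mem_intrinsicInterior hh hv)
  have h2 := hl _ h1
  have h3 := hl _ hx
  simp only [map_add, map_smul, map_sub, smul_eq_mul] at h2
  nlinarith

theorem convexHull_inter_eq_of_le {C : Set E} (l : E →ₗ[ℝ] ℝ) {M : ℝ} (hl : ∀ y ∈ C, l y ≤ M)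
    {x : E} (hx : x ∈ convexHull ℝ C) (hxM : l x = M) :
    x ∈ convexHull ℝ {y | y ∈ C ∧ l y = M} := by
  have hF : ∀ z ∈ convexHull ℝ {y | y ∈ C ∧ l y = M}, l z = M := fun z hz =>
    convexHull_min (t := {z | l z = M}) (fun y hy => hy.2) (convex_hyperplane l.isLinear M) hz
  have key : convexHull ℝ C ⊆ {z | l z < M ∨ z ∈ convexHull ℝ {y | y ∈ C ∧ l y = M}} := by
    refine convexHull_min (fun y hy => ?_) ?_
    · rcases (hl y hy).lt_or_eq with h | h
      · exact Or.inl h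
      · exact Or.inr (subset_convexHull ℝ _ ⟨hy, h⟩)
    · rw [convex_iff_forall_pos]
      intro y hy z hz a b ha hb hab
      have hb' : b = 1 - a := by linarith
      rcases hy with hy | hy
      · left
        have : l z ≤ M := hz.elim le_of_lt fun h => (hF z h).le
        simp only [map_add, map_smul, smul_eq_mul]
        subst hb'
        nlinarith
      · rcases hz with hz | hz
        · left
          have := hF y hy
          simp only [map_add, map_smul, smul_eq_mul]
          subst hb'
          nlinarith
        · exact Or.inr (convex_convexHull ℝ _ hy hz ha.le hb.le hab)
  rcases key hx with h | h
  · exact absurd hxM h.ne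
  · exact h

theorem isExtreme_convexHull_inter {C : Set E} (l : E →ₗ[ℝ] ℝ) {M : ℝ} (hl : ∀ y ∈ C, l y ≤ M) :
    IsExtreme ℝ (convexHull ℝ C) (convexHull ℝ {y | y ∈ C ∧ l y = M}) := by
  have hF : ∀ z ∈ convexHull ℝ {y | y ∈ C ∧ l y = M}, l z = M := fun z hz =>
    convexHull_min (t := {z | l z = M}) (fun y hy => hy.2) (convex_hyperplane l.isLinear M) hz
  have hC : ∀ z ∈ convexHull ℝ C, l z ≤ M := fun z hz =>
    convexHull_min (t := {z | l z ≤ M}) hl (convex_halfSpace_le l.isLinear M) hz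
  refine ⟨convexHull_mono fun y hy => hy.1, ?_⟩
  rintro x hx y hy z hz ⟨a, b, ha, hb, hab, rfl⟩
  have h1 := hF _ hz
  have h2 := hC x hx
  have h3 := hC y hy
  simp only [map_add, map_smul, smul_eq_mul] at h1
  refine convexHull_inter_eq_of_le l hl hx ?_
  have hb' : b = 1 - a := by linarith
  subst hb'
  nlinarith

variable [FiniteDimensional ℝ E]

/-- A point of a convex set outside the relative interior has a supporting functional that is not
constant on the set. -/
theorem exists_supporting_of_notMem_intrinsicInterior {Q : Set E} (hQ : Convex ℝ Q) {h : E}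
    (hh : h ∈ Q) (hi : h ∉ intrinsicInterior ℝ Q) :
    ∃ l : E →ₗ[ℝ] ℝ, (∀ y ∈ Q, l y ≤ l h) ∧ ∃ y ∈ Q, l y < l h := by
  have hmem : h ∈ affineSpan ℝ Q := subset_affineSpan ℝ Q hh
  have : Nonempty (affineSpan ℝ Q) := ⟨⟨h, hmem⟩⟩
  -- Translating `h` to the origin of the direction space turns relative interior into interior,
  -- where Hahn–Banach applies.
  let W := (affineSpan ℝ Q).direction
  let φ : W ≃ᵃⁱ[ℝ] affineSpan ℝ Q := AffineIsometryEquiv.vaddConst ℝ ⟨h, hmem⟩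
  have hφ : ∀ w : W, ((φ w : affineSpan ℝ Q) : E) = w + h := fun w => rfl
  let Q' : Set W := {w | (w : E) + h ∈ Q}
  have hQ' : Q' = φ.toHomeomorph ⁻¹' ((↑) ⁻¹' Q) := by
    ext w
    exact Iff.rfl
  have hint : interior Q' = φ.toHomeomorph ⁻¹' interior ((↑) ⁻¹' Q) := by
    rw [hQ', φ.toHomeomorph.preimage_interior]
  have hconv : Convex ℝ Q' := by
    intro x hx y hy a b ha hb hab
    have := hQ hx hy ha hb hab
    have h1 : ((a • x + b • y : W) : E) + h = a • ((x : E) + h) + b • ((y : E) + h) := by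
      have : h = (a + b) • h := by rw [hab, one_smul]
      push_cast
      conv_lhs => rw [this]
      module
    show ((a • x + b • y : W) : E) + h ∈ Q
    rwa [h1]
  have hne : (interior Q').Nonempty := by
    obtain ⟨z, hz⟩ := Set.Nonempty.intrinsicInterior hQ ⟨h, hh⟩
    obtain ⟨y, hy, -⟩ := mem_intrinsicInterior.1 hz
    refine ⟨φ.symm y, ?_⟩
    rw [hint]
    show φ (φ.symm y) ∈ interior ((↑) ⁻¹' Q : Set (affineSpan ℝ Q))
    rwa [AffineIsometryEquiv.apply_symm_apply]
  have h0 : (0 : W) ∉ interior Q' := by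
    intro h0
    rw [hint] at h0
    exact hi (mem_intrinsicInterior.2 ⟨_, h0, by
      show ((φ 0 : affineSpan ℝ Q) : E) = h
      rw [hφ]; simp⟩)
  obtain ⟨f, hf⟩ := geometric_hahn_banach_open_point hconv.interior isOpen_interior h0
  obtain ⟨l, hl⟩ := (f : W →ₗ[ℝ] ℝ).exists_extend
  have hlf : ∀ w : W, l (w : E) = f w := fun w => by
    have := LinearMap.congr_fun hl w
    simpa using this
  have hsub : ∀ w ∈ Q', f w ≤ 0 := by
    have hcl : closure (interior Q') ⊆ {w | f w ≤ 0} := by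
      refine closure_minimal (fun w hw => ?_) (isClosed_le f.continuous continuous_const)
      have := hf w hw
      rw [map_zero] at this
      exact this.le
    intro w hw
    refine hcl ?_
    rw [hconv.closure_interior_eq_closure_of_nonempty_interior hne]
    exact subset_closure hw
  refine ⟨l, fun y hy => ?_, ?_⟩
  · have hw : y - h ∈ W := AffineSubspace.vsub_mem_direction (subset_affineSpan ℝ Q hy) hmem
    have := hsub ⟨y - h, hw⟩ (by show y - h + h ∈ Q; simpa using hy)
    rw [← hlf] at this
    simpa using this
  · obtain ⟨w, hw⟩ := hne
    have hwQ : w ∈ Q' := interior_subset hw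
    refine ⟨(w : E) + h, hwQ, ?_⟩
    have := hf w hw
    rw [map_zero, ← hlf] at this
    simpa using this

/-- Descend to the face on which a supporting functional at `h` is maximal; it is a strictly smaller
cell as long as `h` is not relatively interior. -/
theorem IsSubdivision.exists_face {A : Set E} {S : Set (Set E)} (hS : IsSubdivision A S)
    (hA : A.Finite) {h : E} {C : Set E} (hC : C ∈ S) (hh : h ∈ convexHull ℝ C) :
    ∃ F ∈ S, IsExtreme ℝ (convexHull ℝ C) (convexHull ℝ F) ∧
      h ∈ intrinsicInterior ℝ (convexHull ℝ F) := by
  induction hm : C.ncard using Nat.strong_induction_on generalizing C with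
  | _ m ih =>
    by_cases hi : h ∈ intrinsicInterior ℝ (convexHull ℝ C)
    · exact ⟨C, hC, IsExtreme.refl ℝ _, hi⟩
    obtain ⟨l, hl, y, hy, hyl⟩ :=
      exists_supporting_of_notMem_intrinsicInterior (convex_convexHull ℝ C) hh hi
    have hlC : ∀ y ∈ C, l y ≤ l h := fun y hy => hl y (subset_convexHull ℝ C hy)
    set F : Set E := {y | y ∈ C ∧ l y = l h} with hF
    have hhF : h ∈ convexHull ℝ F := convexHull_inter_eq_of_le l hlC hh rfl
    have hFne : F.Nonempty := convexHull_nonempty_iff.1 ⟨h, hhF⟩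
    have hface : IsConfigFace F C := by
      refine ⟨hFne, l, ?_⟩
      ext x
      constructor
      · rintro ⟨h1, h2⟩
        exact ⟨h1, fun y hy => h2 ▸ hlC y hy⟩
      · rintro ⟨h1, h2⟩
        obtain ⟨z, hz⟩ := hFne
        exact ⟨h1, le_antisymm (hlC x h1) (hz.2 ▸ h2 z hz.1)⟩
    have hss : F ⊂ C := by
      refine ⟨fun x hx => hx.1, fun hCF => ?_⟩
      have : convexHull ℝ C ⊆ {z | l z = l h} :=
        convexHull_min (fun x hx => (hCF hx).2) (convex_hyperplane l.isLinear _)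
      exact hyl.ne (this hy)
    have hlt : F.ncard < m := hm ▸ Set.ncard_lt_ncard hss (hA.subset (hS.subset C hC))
    obtain ⟨G, hG, h1, h2⟩ := ih _ hlt (hS.closure C hC F hface) hhF rfl
    exact ⟨G, hG, (isExtreme_convexHull_inter l hlC).trans h1, h2⟩

/-- The face of `C` with `h` in its relative interior is a cell, and disjointness of relative
interiors identifies it with `H`. -/
theorem IsSubdivision.isExtreme_of_mem {A : Set E} {S : Set (Set E)} (hS : IsSubdivision A S)
    (hA : A.Finite) {h : E} {C H : Set E} (hH : H ∈ S) (hh : h ∈ intrinsicInterior ℝ (convexHull ℝ H))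
    (hC : C ∈ S) (hhC : h ∈ convexHull ℝ C) :
    IsExtreme ℝ (convexHull ℝ C) (convexHull ℝ H) := by
  obtain ⟨F, hF, h1, h2⟩ := hS.exists_face hA hC hhC
  by_cases hFH : F = H
  · exact hFH ▸ h1
  · exact absurd hh (Set.disjoint_left.1 (hS.inter F hF H hH hFH) h2)

end RelativeInterior

/-! ### Vertices of hypersimplices -/

section Hypersimplex

variable {d n : ℕ}

theorem convex_hypersimplex : Convex ℝ (hypersimplex d n) := by
  intro x hx y hy a b ha hb hab
  refine ⟨fun i => ?_, ?_⟩
  · have h1 := hx.1 i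
    have h2 := hy.1 i
    exact (convex_Icc (0 : ℝ) 1) h1 h2 ha hb hab
  · simp only [Pi.add_apply, Pi.smul_apply, smul_eq_mul, Finset.sum_add_distrib, ← Finset.mul_sum,
      hx.2, hy.2]
    rw [← add_mul, hab, one_mul]

theorem isClosed_hypersimplex : IsClosed (hypersimplex d n) := by
  have h1 : IsClosed {x : Fin n → ℝ | ∀ i, x i ∈ Set.Icc (0 : ℝ) 1} := by
    simp only [Set.ofPred_forall]
    exact isClosed_iInter fun i => isClosed_Icc.preimage (continuous_apply i)
  exact h1.inter (isClosed_eq (by fun_prop) continuous_const)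

theorem isCompact_hypersimplex : IsCompact (hypersimplex d n) := by
  refine (isCompact_univ_pi fun _ : Fin n => isCompact_Icc (a := (0 : ℝ)) (b := 1)).of_isClosed_subset
    isClosed_hypersimplex fun x hx i _ => hx.1 i

theorem mem_hypersimplexVertices_iff {x : Fin n → ℝ} :
    x ∈ hypersimplexVertices d n ↔ (∀ i, x i = 0 ∨ x i = 1) ∧ ∑ i, x i = d := by
  constructor
  · intro hx
    have hxP : x ∈ hypersimplex d n := hx.1
    refine ⟨fun e => ?_, hxP.2⟩
    by_contra! he
    -- The coordinate sum is an integer, so one fractional coordinate forces a second. Shifting mass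
    -- between them both ways contradicts extremality.
    obtain ⟨b, hbe, hb0, hb1⟩ : ∃ b, b ≠ e ∧ x b ≠ 0 ∧ x b ≠ 1 := by
      by_contra! hcon
      have h1 : ∃ m : ℤ, ∑ i ∈ Finset.univ.erase e, x i = m := by
        refine ⟨∑ i ∈ Finset.univ.erase e, if x i = 0 then 0 else 1, ?_⟩
        push_cast
        refine Finset.sum_congr rfl fun i hi => ?_
        by_cases h0 : x i = 0
        · simp [h0]
        · simp [hcon i (Finset.ne_of_mem_erase hi) h0]
      obtain ⟨m, hm⟩ := h1
      have h2 := Finset.add_sum_erase Finset.univ x (Finset.mem_univ e)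
      rw [hm, hxP.2] at h2
      have h3 : x e = ((d - m : ℤ) : ℝ) := by push_cast; linarith
      have h4 := hxP.1 e
      have h5 : 0 < x e := lt_of_le_of_ne h4.1 (Ne.symm he.1)
      have h6 : x e < 1 := lt_of_le_of_ne h4.2 he.2
      rw [h3] at h5 h6
      have h7 : 0 < (d - m : ℤ) := by exact_mod_cast h5
      have h8 : (d - m : ℤ) < 1 := by exact_mod_cast h6
      omega
    have h4 := hxP.1 e
    have h5 := hxP.1 b
    have e0 : 0 < x e := lt_of_le_of_ne h4.1 (Ne.symm he.1)
    have e1 : x e < 1 := lt_of_le_of_ne h4.2 he.2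
    have b0 : 0 < x b := lt_of_le_of_ne h5.1 (Ne.symm hb0)
    have b1 : x b < 1 := lt_of_le_of_ne h5.2 hb1
    obtain ⟨ε, hε, hεe, hεe', hεb, hεb'⟩ : ∃ ε > 0, ε < x e ∧ ε < 1 - x e ∧ ε < x b ∧ ε < 1 - x b := by
      obtain ⟨ε, h1, h2⟩ := exists_between (show (0 : ℝ) < min (min (x e) (1 - x e)) (min (x b) (1 - x b))
        by simp only [lt_min_iff]; refine ⟨⟨?_, ?_⟩, ?_, ?_⟩ <;> linarith)
      simp only [lt_min_iff] at h2
      exact ⟨ε, h1, h2.1.1, h2.1.2, h2.2.1, h2.2.2⟩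
    let v : Fin n → ℝ := Pi.single e ε - Pi.single b ε
    have hve : v e = ε := by simp [v, hbe.symm]
    have hvb : v b = -ε := by simp [v, hbe]
    have hvo : ∀ i, i ≠ e → i ≠ b → v i = 0 := fun i h1 h2 => by simp [v, h1, h2]
    have hvs : ∑ i, v i = 0 := by simp [v, Finset.sum_sub_distrib]
    have hmem : ∀ s : ℝ, s = 1 ∨ s = -1 → x + s • v ∈ hypersimplex d n := by
      intro s hs
      refine ⟨fun i => ?_, ?_⟩
      · by_cases h1 : i = e
        · subst h1
          simp only [Pi.add_apply, Pi.smul_apply, smul_eq_mul, hve, Set.mem_Icc]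
          rcases hs with rfl | rfl <;> constructor <;> linarith
        · by_cases h2 : i = b
          · subst h2
            simp only [Pi.add_apply, Pi.smul_apply, smul_eq_mul, hvb, Set.mem_Icc]
            rcases hs with rfl | rfl <;> constructor <;> linarith
          · simpa [hvo i h1 h2] using hxP.1 i
      · simp only [Pi.add_apply, Pi.smul_apply, smul_eq_mul, Finset.sum_add_distrib,
          ← Finset.mul_sum, hvs, hxP.2]
        simp
    have := (mem_extremePoints_iff_left.1 hx).2 _ (hmem 1 (Or.inl rfl)) _ (hmem (-1) (Or.inr rfl))
      ⟨1 / 2, 1 / 2, by norm_num, by norm_num, by norm_num, by module⟩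
    have h6 := congrFun this e
    simp only [Pi.add_apply, Pi.smul_apply, smul_eq_mul, hve] at h6
    linarith
  · rintro ⟨h01, hs⟩
    refine mem_extremePoints_iff_left.2 ⟨⟨fun i => ?_, hs⟩, ?_⟩
    · rcases h01 i with h | h <;> simp [h]
    · rintro y hy z hz ⟨a, b, ha, hb, hab, rfl⟩
      funext i
      have h1 := hy.1 i
      have h2 := hz.1 i
      have h3 := h01 i
      simp only [Pi.add_apply, Pi.smul_apply, smul_eq_mul, Set.mem_Icc] at h1 h2 h3 ⊢
      have hb' : b = 1 - a := by linarith
      subst hb'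
      rcases h3 with h3 | h3
      · nlinarith
      · nlinarith

theorem finite_hypersimplexVertices : (hypersimplexVertices d n).Finite := by
  refine Set.Finite.subset (Set.Finite.pi (t := fun _ : Fin n => ({0, 1} : Set ℝ))
    fun _ => by simp) fun x hx i _ => ?_
  simpa using (mem_hypersimplexVertices_iff.1 hx).1 i

theorem convexHull_hypersimplexVertices :
    convexHull ℝ (hypersimplexVertices d n) = hypersimplex d n := by
  rw [← closure_convexHull_extremePoints isCompact_hypersimplex convex_hypersimplex]
  exact (finite_hypersimplexVertices.isClosed_convexHull ℝ).closure_eq.symm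

end Hypersimplex

/-! ### Families of separating functionals -/

section Separation

variable {E : Type*} [NormedAddCommGroup E] [NormedSpace ℝ E]

theorem exists_separating_functional {K K' : Set E} (hK : Convex ℝ K) (hK' : Convex ℝ K')
    (hi : (interior K).Nonempty) (hi' : (interior K').Nonempty)
    (hd : Disjoint (interior K) (interior K')) (h0 : 0 ∈ K) (h0' : 0 ∈ K') :
    ∃ f : E →ₗ[ℝ] ℝ, (∀ v ∈ K, 0 ≤ f v) ∧ (∀ v ∈ K', f v ≤ 0) ∧ (∀ v ∈ interior K, 0 < f v) ∧
      ∀ v ∈ interior K', f v < 0 := by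
  obtain ⟨f, u, h1, h2⟩ := geometric_hahn_banach_open_open hK'.interior isOpen_interior
    hK.interior isOpen_interior hd.symm
  have hle : ∀ v ∈ K, u ≤ f v := by
    have : closure (interior K) ⊆ {v | u ≤ f v} :=
      closure_minimal (fun v hv => (h2 v hv).le) (isClosed_le continuous_const f.continuous)
    intro v hv
    refine this ?_
    rw [hK.closure_interior_eq_closure_of_nonempty_interior hi]
    exact subset_closure hv
  have hle' : ∀ v ∈ K', f v ≤ u := by
    have : closure (interior K') ⊆ {v | f v ≤ u} :=
      closure_minimal (fun v hv => (h1 v hv).le) (isClosed_le f.continuous continuous_const)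
    intro v hv
    refine this ?_
    rw [hK'.closure_interior_eq_closure_of_nonempty_interior hi']
    exact subset_closure hv
  have hu : u = 0 := by
    have h3 := hle 0 h0
    have h4 := hle' 0 h0'
    rw [map_zero] at h3 h4
    exact le_antisymm h3 h4
  subst hu
  exact ⟨f, hle, hle', h2, h1⟩

theorem exists_separating_family {ι : Type*} {K : ι → Set E} {U : Set E}
    (hU : Convex ℝ U) (hKU : ∀ v ∈ U, ∃ i, v ∈ K i) (hUK : ∀ i, K i ⊆ U)
    (hK : ∀ i, Convex ℝ (K i)) (hc : ∀ i, IsClosed (K i)) (hi : ∀ i, (interior (K i)).Nonempty)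
    (hd : ∀ i j, i ≠ j → Disjoint (interior (K i)) (interior (K j))) (h0 : ∀ i, 0 ∈ K i) :
    ∃ D : ι → ι → E →ₗ[ℝ] ℝ, (∀ i j v, D i j v = -D j i v) ∧
      ∀ i v, v ∈ K i ↔ v ∈ U ∧ ∀ j, 0 ≤ D i j v := by
  have hex : ∀ i j, ∃ f : E →ₗ[ℝ] ℝ, i ≠ j → (∀ v ∈ K i, 0 ≤ f v) ∧ (∀ v ∈ K j, f v ≤ 0) ∧
      (∀ v ∈ interior (K i), 0 < f v) ∧ ∀ v ∈ interior (K j), f v < 0 := by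
    intro i j
    by_cases hij : i = j
    · exact ⟨0, fun h => absurd hij h⟩
    · obtain ⟨f, hf⟩ := exists_separating_functional (hK i) (hK j) (hi i) (hi j) (hd i j hij)
        (h0 i) (h0 j)
      exact ⟨f, fun _ => hf⟩
  choose f hf using hex
  -- Separators chosen independently for `(i, j)` and `(j, i)` need not be opposite; their
  -- difference is antisymmetric and still separates.
  let D : ι → ι → E →ₗ[ℝ] ℝ := fun i j => f i j - f j i
  have hDle : ∀ i j, ∀ v ∈ K i, 0 ≤ D i j v := by
    intro i j v hv
    by_cases hij : i = j
    · subst hij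
      simp [D]
    · have h1 := (hf i j hij).1 v hv
      have h2 := (hf j i (Ne.symm hij)).2.1 v hv
      simp only [D, LinearMap.sub_apply]
      linarith
  have hDlt : ∀ i j, i ≠ j → ∀ v ∈ interior (K i), 0 < D i j v := by
    intro i j hij v hv
    have h1 := (hf i j hij).2.2.1 v hv
    have h2 := (hf j i (Ne.symm hij)).2.2.2 v hv
    simp only [D, LinearMap.sub_apply]
    linarith
  have hanti : ∀ i j v, D i j v = -D j i v := fun i j v => by simp [D]
  refine ⟨D, hanti, fun i v => ⟨fun hv => ⟨hUK i hv, fun j => hDle i j v hv⟩, ?_⟩⟩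
  rintro ⟨hv, hD⟩
  obtain ⟨z, hz⟩ := hi i
  -- On the way from `v` to an interior point `z` of `K i`, every `D i l` with `l ≠ i` is strictly
  -- positive, so no other member can contain the point. Closedness then gives `v` itself.
  have hmem : ∀ t : ℝ, 0 < t → t < 1 → (1 - t) • v + t • z ∈ K i := by
    intro t ht ht1
    have hUt : (1 - t) • v + t • z ∈ U :=
      hU hv (hUK i (interior_subset hz)) (by linarith) ht.le (by ring)
    obtain ⟨l, hl⟩ := hKU _ hUt
    by_cases hli : i = l
    · exact hli ▸ hl
    · have h1 := hDle l i _ hl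
      have h2 := hDlt i l hli z hz
      have h3 := hD l
      rw [hanti] at h1
      simp only [map_add, map_smul, smul_eq_mul] at h1
      nlinarith [mul_pos ht h2, mul_nonneg (sub_pos.2 ht1).le h3]
  have hlim : Filter.Tendsto (fun t : ℝ => (1 - t) • v + t • z) (nhdsWithin 0 (Set.Ioi 0)) (nhds v) := by
    have : Continuous fun t : ℝ => (1 - t) • v + t • z := by fun_prop
    have h1 := this.tendsto 0
    simp only [sub_zero, one_smul, zero_smul, add_zero] at h1
    exact h1.mono_left nhdsWithin_le_nhds
  refine (hc i).mem_of_tendsto hlim ?_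
  filter_upwards [Ioo_mem_nhdsGT (show (0 : ℝ) < 1 by norm_num)] with t ht
  exact hmem t ht.1 ht.2

theorem interior_biUnion_eq_empty {X ι : Type*} [TopologicalSpace X] {s : Set ι} (hs : s.Finite)
    {K : ι → Set X} (hc : ∀ i ∈ s, IsClosed (K i)) (hi : ∀ i ∈ s, interior (K i) = ∅) :
    interior (⋃ i ∈ s, K i) = ∅ := by
  induction s, hs using Set.Finite.induction_on with
  | empty => simp
  | @insert a s _ hs ih =>
    rw [Set.biUnion_insert, interior_union_isClosed_of_interior_empty (hc a (by simp))
      (ih (fun i h => hc i (by simp [h])) fun i h => hi i (by simp [h]))]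
    exact hi a (by simp)

/-- A finite closed cover of a convex set with nonempty interior stays a cover when the members
with empty interior are removed. -/
theorem exists_mem_of_nonempty_interior {ι : Type*} {s : Set ι} (hs : s.Finite) {K : ι → Set E}
    (hc : ∀ i ∈ s, IsClosed (K i)) {U : Set E} (hU : Convex ℝ U) (hi : (interior U).Nonempty)
    (hcov : ∀ v ∈ U, ∃ i ∈ s, v ∈ K i) {v : E} (hv : v ∈ U) :
    ∃ i ∈ s, (interior (K i)).Nonempty ∧ v ∈ K i := by
  let s1 : Set ι := {i | i ∈ s ∧ (interior (K i)).Nonempty}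
  let s2 : Set ι := {i | i ∈ s ∧ interior (K i) = ∅}
  have hs1 : s1.Finite := hs.subset fun i h => h.1
  have hs2 : s2.Finite := hs.subset fun i h => h.1
  have hG : IsClosed (⋃ i ∈ s1, K i) := hs1.isClosed_biUnion fun i h => hc i h.1
  -- This open set is covered by finitely many closed sets with empty interior, hence is empty.
  have hsub : interior U \ (⋃ i ∈ s1, K i) ⊆ interior (⋃ i ∈ s2, K i) := by
    refine interior_maximal ?_ (isOpen_interior.sdiff hG)
    rintro x ⟨hx, hx'⟩
    obtain ⟨i, his, hxi⟩ := hcov x (interior_subset hx)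
    rcases Set.eq_empty_or_nonempty (interior (K i)) with h | h
    · exact Set.mem_biUnion (show i ∈ s2 from ⟨his, h⟩) hxi
    · exact absurd (Set.mem_biUnion (show i ∈ s1 from ⟨his, h⟩) hxi) hx'
  rw [interior_biUnion_eq_empty hs2 (fun i h => hc i h.1) fun i h => h.2] at hsub
  have h1 : interior U ⊆ ⋃ i ∈ s1, K i := by
    intro x hx
    by_contra hx'
    exact hsub ⟨hx, hx'⟩
  have h2 : v ∈ ⋃ i ∈ s1, K i := by
    refine closure_minimal h1 hG ?_
    rw [hU.closure_interior_eq_closure_of_nonempty_interior hi]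
    exact subset_closure hv
  simp only [Set.mem_iUnion] at h2
  obtain ⟨i, hi, hvi⟩ := h2
  exact ⟨i, hi.1, hi.2, hvi⟩

end Separation

/-! ### The fan of a split of a hypersimplex -/

section SplitFan

variable {d n : ℕ}

/-- A simplicial fan whose cones subdivide the hypersimplex into polytopes spanned by vertices of
the hypersimplex, and whose common cone contains the relatively interior point `h`. -/
structure IsHypersimplexFan {ι : Type*} (d n : ℕ) (D : ι → ι → (Fin n → ℝ) →ₗ[ℝ] ℝ)
    (h : Fin n → ℝ) : Prop where
  fan : IsSimplicialFan D
  pos : ∀ e, 0 < h e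
  lt_one : ∀ e, h e < 1
  sum_eq : ∑ e, h e = d
  apply_eq_zero : ∀ i j, D i j h = 0
  gen : ∀ i, ∀ x ∈ hypersimplex d n, (∀ j, 0 ≤ D i j x) →
    x ∈ convexHull ℝ {y | y ∈ hypersimplexVertices d n ∧ ∀ j, 0 ≤ D i j y}

/-- The projection of `ℝ^n` along `h` onto the hyperplane of vectors with coordinate sum zero, for
`h` with coordinate sum `d`. -/
noncomputable def sumZeroProj (d : ℕ) (h : Fin n → ℝ) : (Fin n → ℝ) →ₗ[ℝ] (Fin n → ℝ) :=
  LinearMap.id - (∑ e, LinearMap.proj e : (Fin n → ℝ) →ₗ[ℝ] ℝ).smulRight ((d : ℝ)⁻¹ • h)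

theorem sumZeroProj_apply (h v : Fin n → ℝ) :
    sumZeroProj d h v = v - (∑ e, v e) • ((d : ℝ)⁻¹ • h) := by
  simp [sumZeroProj]

theorem sumZeroProj_of_sum_eq_zero (h : Fin n → ℝ) {v : Fin n → ℝ} (hv : ∑ e, v e = 0) :
    sumZeroProj d h v = v := by
  simp [sumZeroProj_apply, hv]

theorem sum_sumZeroProj {h : Fin n → ℝ} (hd : d ≠ 0) (hs : ∑ e, h e = d) (v : Fin n → ℝ) :
    ∑ e, sumZeroProj d h v e = 0 := by
  have : (d : ℝ) ≠ 0 := by exact_mod_cast hd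
  simp [sumZeroProj_apply, Finset.sum_sub_distrib, ← Finset.mul_sum, hs, this]

theorem sumZeroProj_self {h : Fin n → ℝ} (hd : d ≠ 0) (hs : ∑ e, h e = d) :
    sumZeroProj d h h = 0 := by
  have : (d : ℝ) ≠ 0 := by exact_mod_cast hd
  rw [sumZeroProj_apply, hs, smul_smul, mul_inv_cancel₀ this, one_smul, sub_self]

theorem continuous_add_sumZeroProj (h : Fin n → ℝ) :
    Continuous fun v => h + sumZeroProj d h v :=
  continuous_const.add (LinearMap.continuous_of_finiteDimensional _)

theorem mem_intrinsicInterior_of_mem_interior {h v : Fin n → ℝ} {Q : Set (Fin n → ℝ)}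
    (hd : d ≠ 0) (hs : ∑ e, h e = d) (hQ : Q ⊆ hypersimplex d n)
    (hv : v ∈ interior {v | h + sumZeroProj d h v ∈ Q}) :
    h + sumZeroProj d h v ∈ intrinsicInterior ℝ Q := by
  have hmem : h + sumZeroProj d h v ∈ Q := by
    have : v ∈ {v | h + sumZeroProj d h v ∈ Q} := interior_subset hv
    exact this
  refine mem_intrinsicInterior.2 ⟨⟨_, subset_affineSpan ℝ Q hmem⟩, ?_, rfl⟩
  have hsum : ∀ y ∈ affineSpan ℝ Q, ∑ e, y e = d := by
    intro y hy
    have h1 : affineSpan ℝ Q ≤ AffineSubspace.mk' h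
        (LinearMap.ker (∑ e, LinearMap.proj e : (Fin n → ℝ) →ₗ[ℝ] ℝ)) := by
      refine affineSpan_le.2 fun z hz => ?_
      rw [SetLike.mem_coe, AffineSubspace.mem_mk', LinearMap.mem_ker]
      simp [Finset.sum_sub_distrib, hs, (hQ hz).2]
    have h2 := h1 hy
    rw [AffineSubspace.mem_mk', LinearMap.mem_ker] at h2
    simp only [vsub_eq_sub, map_sub, LinearMap.sum_apply, LinearMap.proj_apply, hs] at h2
    linarith
  let f : affineSpan ℝ Q → (Fin n → ℝ) := fun y => (y : Fin n → ℝ) - h - sumZeroProj d h v + v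
  have hf : Continuous f := by
    have := continuous_subtype_val (p := fun y => y ∈ affineSpan ℝ Q)
    exact ((this.sub continuous_const).sub continuous_const).add continuous_const
  have hfy : ∀ y : affineSpan ℝ Q, h + sumZeroProj d h (f y) = y := by
    intro y
    have h1 : sumZeroProj d h ((y : Fin n → ℝ) - h) = y - h :=
      sumZeroProj_of_sum_eq_zero h (by simp [Finset.sum_sub_distrib, hs, hsum y y.2])
    have h2 : sumZeroProj d h (sumZeroProj d h v) = sumZeroProj d h v :=
      sumZeroProj_of_sum_eq_zero h (sum_sumZeroProj hd hs v)
    simp only [f]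
    rw [map_add, map_sub, h1, h2]
    abel
  refine mem_interior.2 ⟨f ⁻¹' interior {v | h + sumZeroProj d h v ∈ Q}, ?_,
    isOpen_interior.preimage hf, ?_⟩
  · intro y hy
    have h1 : f y ∈ {v | h + sumZeroProj d h v ∈ Q} := interior_subset hy
    have h2 : h + sumZeroProj d h (f y) ∈ Q := h1
    rw [hfy] at h2
    exact h2
  · show f ⟨h + sumZeroProj d h v, subset_affineSpan ℝ Q hmem⟩ ∈
      interior {v | h + sumZeroProj d h v ∈ Q}
    have : f ⟨h + sumZeroProj d h v, subset_affineSpan ℝ Q hmem⟩ = v := by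
      simp only [f]; abel
    rw [this]
    exact hv

/-- If a coordinate of `h` were extremal, it would be constant on the hull of `H`. Some point of
that hull is relatively interior in the hypersimplex, so it would be constant there too, contrary to
the barycenter with all coordinates `d / n`. -/
theorem coord_bounds_of_mem_intrinsicInterior {H : Set (Fin n → ℝ)} (hd : 0 < d) (hdn : d < n)
    (hHA : H ⊆ hypersimplexVertices d n)
    (hint : ¬ convexHull ℝ H ⊆ intrinsicFrontier ℝ (convexHull ℝ (hypersimplexVertices d n)))
    {h : Fin n → ℝ} (hh : h ∈ intrinsicInterior ℝ (convexHull ℝ H)) (e : Fin n) :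
    0 < h e ∧ h e < 1 := by
  have hHP : convexHull ℝ H ⊆ hypersimplex d n := by
    rw [← convexHull_hypersimplexVertices]
    exact convexHull_mono hHA
  rw [convexHull_hypersimplexVertices] at hint
  obtain ⟨x, hx, hxf⟩ := Set.not_subset.1 hint
  have hxi : x ∈ intrinsicInterior ℝ (hypersimplex d n) := by
    have h1 := subset_intrinsicClosure (𝕜 := ℝ) (hHP hx)
    rw [← intrinsicInterior_union_intrinsicFrontier] at h1
    exact h1.resolve_right hxf
  have hn : (0 : ℝ) < n := by exact_mod_cast hd.trans hdn
  have hd' : (0 : ℝ) < d := by exact_mod_cast hd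
  have hdn' : (d : ℝ) < n := by exact_mod_cast hdn
  have hc : (fun _ => (d : ℝ) / n : Fin n → ℝ) ∈ hypersimplex d n := by
    refine ⟨fun i => ⟨by positivity, (div_le_one hn).2 hdn'.le⟩, ?_⟩
    simp [mul_div_cancel₀ _ hn.ne']
  have hhP := hHP (intrinsicInterior_subset hh)
  constructor
  · refine lt_of_le_of_ne (hhP.1 e).1 fun h0 => ?_
    have h1 := eq_of_mem_intrinsicInterior_of_le hh (-LinearMap.proj e)
      (fun y hy => by simpa [← h0] using ((hHP hy).1 e).1) hx
    have h2 := eq_of_mem_intrinsicInterior_of_le hxi (-LinearMap.proj e)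
      (fun y hy => by rw [h1]; simpa [← h0] using (hy.1 e).1) hc
    rw [h1] at h2
    simp only [LinearMap.neg_apply, LinearMap.proj_apply, ← h0] at h2
    have := div_pos hd' hn
    linarith
  · refine lt_of_le_of_ne (hhP.1 e).2 fun h0 => ?_
    have h1 := eq_of_mem_intrinsicInterior_of_le hh (LinearMap.proj e)
      (fun y hy => by simpa [h0] using ((hHP hy).1 e).2) hx
    have h2 := eq_of_mem_intrinsicInterior_of_le hxi (LinearMap.proj e)
      (fun y hy => by rw [h1]; simpa [h0] using (hy.1 e).2) hc
    rw [h1] at h2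
    simp only [LinearMap.proj_apply, h0] at h2
    rw [div_eq_one_iff_eq hn.ne'] at h2
    exact hdn'.ne h2

/-- For `d = 0` or `d = n` there is at most one vertex, so any cell is the whole configuration and
the subdivision is trivial. -/
theorem IsKSplit.pos_and_lt {k : ℕ} (hdn : d ≤ n) {S : Set (Set (Fin n → ℝ))}
    (hS : IsKSplit (hypersimplexVertices d n) k S) : 0 < d ∧ d < n := by
  obtain ⟨H, hH⟩ := hS.exists_common
  have hsub := hS.coarsest.1.subset H hH.mem
  obtain ⟨x, hx⟩ := hS.coarsest.1.nonempty H hH.mem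
  have key : ¬ (hypersimplexVertices d n).Subsingleton := by
    intro hss
    apply hS.coarsest.2.1
    have : hypersimplexVertices d n = H :=
      Set.Subset.antisymm (fun y hy => hss hy (hsub hx) ▸ hx) hsub
    rw [this]
    exact hH.mem
  constructor
  · rcases Nat.eq_zero_or_pos d with rfl | h
    · refine absurd (fun y hy z hz => ?_) key
      have hzero : ∀ y ∈ hypersimplexVertices 0 n, y = 0 := by
        intro y hy
        have h1 : ∑ i, y i = 0 := by simpa using hy.1.2
        rw [Finset.sum_eq_zero_iff_of_nonneg fun i _ => (hy.1.1 i).1] at h1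
        funext i
        exact h1 i (Finset.mem_univ i)
      rw [hzero y hy, hzero z hz]
    · exact h
  · rcases hdn.eq_or_lt with rfl | h
    · refine absurd (fun y hy z hz => ?_) key
      have hone : ∀ y ∈ hypersimplexVertices d d, y = 1 := by
        intro y hy
        have h1 : ∑ i, (1 - y i) = 0 := by simp [Finset.sum_sub_distrib, hy.1.2]
        rw [Finset.sum_eq_zero_iff_of_nonneg fun i _ => sub_nonneg.2 (hy.1.1 i).2] at h1
        funext i
        have := h1 i (Finset.mem_univ i)
        simp only [Pi.one_apply]
        linarith
      rw [hone y hy, hone z hz]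
    · exact h

/-- A `k`-split of a hypersimplex is cut out by a fan with `k` maximal cones. -/
theorem IsKSplit.exists_isHypersimplexFan {k : ℕ} (hdn : d ≤ n) {S : Set (Set (Fin n → ℝ))}
    (hS : IsKSplit (hypersimplexVertices d n) k S) {H : Set (Fin n → ℝ)}
    (hH : IsCommonCell (hypersimplexVertices d n) k S H) :
    ∃ (ι : Type) (_ : Fintype ι) (D : ι → ι → (Fin n → ℝ) →ₗ[ℝ] ℝ) (h : Fin n → ℝ),
      Fintype.card ι = k ∧ IsHypersimplexFan d n D h ∧
      convexHull ℝ H = {x | x ∈ hypersimplex d n ∧ ∀ i j, D i j x = 0} := by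
  classical
  obtain ⟨hd0, hdn'⟩ := hS.pos_and_lt hdn
  have hsub := hS.coarsest.1
  have hd : d ≠ 0 := hd0.ne'
  have hAfin := finite_hypersimplexVertices (d := d) (n := n)
  have hHA := hsub.subset H hH.mem
  obtain ⟨h, hh⟩ : (intrinsicInterior ℝ (convexHull ℝ H)).Nonempty :=
    Set.Nonempty.intrinsicInterior (convex_convexHull ℝ H)
      (convexHull_nonempty_iff.2 (hsub.nonempty H hH.mem))
  have hbd := coord_bounds_of_mem_intrinsicInterior hd0 hdn' hHA hH.interior hh
  have hcellP : ∀ C ∈ S, convexHull ℝ C ⊆ hypersimplex d n := fun C hC => by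
    rw [← convexHull_hypersimplexVertices]
    exact convexHull_mono (hsub.subset C hC)
  have hhH : h ∈ convexHull ℝ H := intrinsicInterior_subset hh
  have hhP := hcellP H hH.mem hhH
  have hs : ∑ e, h e = d := hhP.2
  set π := sumZeroProj d h with hπ
  have hπc : Continuous fun v => h + π v := continuous_add_sumZeroProj h
  -- Cells are recentred at `h` and pulled back along `π`, which makes them subsets of the full
  -- space with genuine interiors.
  let K : Set (Fin n → ℝ) → Set (Fin n → ℝ) := fun C => {v | h + π v ∈ convexHull ℝ C}
  let U : Set (Fin n → ℝ) := {v | h + π v ∈ hypersimplex d n}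
  have hconv : ∀ Q : Set (Fin n → ℝ), Convex ℝ Q → Convex ℝ {v | h + π v ∈ Q} := by
    intro Q hQ x hx y hy a b ha hb hab
    have h1 := hQ hx hy ha hb hab
    show h + π (a • x + b • y) ∈ Q
    convert h1 using 1
    have : h = (a + b) • h := by rw [hab, one_smul]
    rw [map_add, map_smul, map_smul]
    nth_rw 1 [this]
    module
  have hUconv : Convex ℝ U := hconv _ convex_hypersimplex
  have hU0 : U ∈ nhds (0 : Fin n → ℝ) := by
    have ho : IsOpen {x : Fin n → ℝ | ∀ e, 0 < x e ∧ x e < 1} := by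
      simp only [Set.ofPred_forall]
      exact isOpen_iInter_of_finite fun e =>
        (isOpen_lt continuous_const (continuous_apply e)).inter
          (isOpen_lt (continuous_apply e) continuous_const)
    have h1 : (fun v => h + π v) ⁻¹' {x | ∀ e, 0 < x e ∧ x e < 1} ∈ nhds (0 : Fin n → ℝ) :=
      (ho.preimage hπc).mem_nhds (by
        show ∀ e, 0 < (h + π 0) e ∧ (h + π 0) e < 1
        simpa using hbd)
    refine Filter.mem_of_superset h1 fun v hv => ⟨fun e => ⟨(hv e).1.le, (hv e).2.le⟩, ?_⟩
    simp [Finset.sum_add_distrib, hs, hπ, sum_sumZeroProj hd hs]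
  have hUi : (interior U).Nonempty := ⟨0, mem_interior_iff_mem_nhds.2 hU0⟩
  have hsmall : ∀ v : Fin n → ℝ, ∃ t : ℝ, t > 0 ∧ t • v ∈ U ∧ (-t) • v ∈ U := by
    intro v
    refine exists_pos_of_eventually_nhds_zero ?_
    have : Continuous fun t : ℝ => t • v := by fun_prop
    exact this.tendsto 0 (by simpa using hU0)
  have hSfin : S.Finite := hAfin.finite_subsets.subset fun C hC => hsub.subset C hC
  let M : Set (Set (Fin n → ℝ)) := {C | IsMaximalCell S C}
  have hMS : ∀ C ∈ M, C ∈ S := fun C hC => hC.prop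
  have hMfin : M.Finite := hSfin.subset hMS
  have hcov : ∀ v ∈ U, ∃ C ∈ M, v ∈ K C := by
    intro v hv
    have h1 : h + π v ∈ ⋃ C ∈ S, convexHull ℝ C := by
      rw [hsub.union, convexHull_hypersimplexVertices]
      exact hv
    simp only [Set.mem_iUnion] at h1
    obtain ⟨C, hC, hvC⟩ := h1
    obtain ⟨C', hCC, hC'⟩ := hSfin.exists_le_maximal hC
    exact ⟨C', hC', convexHull_mono hCC hvC⟩
  have hKc : ∀ C ∈ M, IsClosed (K C) := fun C hC =>
    ((hAfin.subset (hsub.subset C (hMS C hC))).isClosed_convexHull ℝ).preimage hπc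
  have hHC : ∀ C ∈ M, convexHull ℝ H ⊆ convexHull ℝ C := fun C hC =>
    convexHull_mono (hH.common C hC)
  let ι : Type := {C : Set (Fin n → ℝ) // C ∈ M ∧ (interior (K C)).Nonempty}
  have : Finite ι := Set.Finite.to_subtype (s := {C | C ∈ M ∧ (interior (K C)).Nonempty})
    (hMfin.subset fun C hC => hC.1)
  let _ : Fintype ι := Fintype.ofFinite ι
  obtain ⟨D, hanti, hD⟩ := exists_separating_family (ι := ι) (K := fun i => K i.1) (U := U) hUconv
    (fun v hv => by
      obtain ⟨C, hC, h1, h2⟩ := exists_mem_of_nonempty_interior hMfin hKc hUconv hUi hcov hv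
      exact ⟨⟨C, hC, h1⟩, h2⟩)
    (fun i v hv => hcellP i.1 (hMS _ i.2.1) hv)
    (fun i => hconv _ (convex_convexHull ℝ _)) (fun i => hKc _ i.2.1) (fun i => i.2.2)
    (fun i j hij => by
      rw [Set.disjoint_left]
      intro v hv hv'
      have hne : i.1 ≠ j.1 := fun h => hij (Subtype.ext h)
      exact Set.disjoint_left.1 (hsub.inter _ (hMS _ i.2.1) _ (hMS _ j.2.1) hne)
        (mem_intrinsicInterior_of_mem_interior hd hs (hcellP _ (hMS _ i.2.1)) hv)
        (mem_intrinsicInterior_of_mem_interior hd hs (hcellP _ (hMS _ j.2.1)) hv'))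
    (fun i => by
      show h + π 0 ∈ convexHull ℝ i.1
      rw [map_zero, add_zero]
      exact hHC _ i.2.1 hhH)
  have hDself : ∀ i v, D i i v = 0 := fun i v => by linarith [hanti i i v]
  have hDh : ∀ i j, D i j h = 0 := by
    have hπh : π h = 0 := sumZeroProj_self hd hs
    intro i j
    have h1 : h ∈ K i.1 := by
      show h + π h ∈ convexHull ℝ i.1
      rw [hπh, add_zero]
      exact hHC _ i.2.1 hhH
    have h2 : -h ∈ K i.1 := by
      show h + π (-h) ∈ convexHull ℝ i.1
      rw [map_neg, hπh, neg_zero, add_zero]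
      exact hHC _ i.2.1 hhH
    have h3 := ((hD i h).1 h1).2 j
    have h4 := ((hD i (-h)).1 h2).2 j
    rw [map_neg] at h4
    linarith
  have hcover : ∀ v, ∃ i, ∀ j, 0 ≤ D i j v := by
    intro v
    obtain ⟨t, ht, h1, -⟩ := hsmall v
    obtain ⟨C, hC, h2, h3⟩ := exists_mem_of_nonempty_interior hMfin hKc hUconv hUi hcov h1
    refine ⟨⟨C, hC, h2⟩, fun j => ?_⟩
    have h4 := ((hD ⟨C, hC, h2⟩ _).1 h3).2 j
    rw [map_smul, smul_eq_mul] at h4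
    exact nonneg_of_mul_nonneg_right h4 ht
  -- If all `D i j` vanish at `v`, cell `i` contains points on both sides of `h` along `π v`. The
  -- hull of `H` is an extreme subset of the cell, so it contains them as well.
  have hcore : ∀ i v, (∀ j, D i j v = 0) → v ∈ U → h + π v ∈ convexHull ℝ H := by
    intro i v hv hvU
    obtain ⟨t, ht, -, h1⟩ := hsmall v
    have h2 : v ∈ K i.1 := (hD i v).2 ⟨hvU, fun j => (hv j).ge⟩
    have h3 : (-t) • v ∈ K i.1 := (hD i _).2 ⟨h1, fun j => by rw [map_smul, hv j, smul_zero]⟩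
    have hext := hsub.isExtreme_of_mem hAfin hH.mem hh (hMS _ i.2.1) (hHC _ i.2.1 hhH)
    refine hext.left_mem_of_mem_openSegment h2 h3 hhH
      ⟨t / (1 + t), 1 / (1 + t), by positivity, by positivity, by field_simp; ring, ?_⟩
    have h5 : (1 + t) ≠ 0 := by positivity
    rw [map_smul]
    have h6 : (t / (1 + t)) • (h + π v) + (1 / (1 + t)) • (h + -t • π v) =
        (t / (1 + t) + 1 / (1 + t)) • h + (t / (1 + t) - 1 / (1 + t) * t) • π v := by module
    rw [h6]
    have h7 : t / (1 + t) + 1 / (1 + t) = 1 := by field_simp; ring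
    have h8 : t / (1 + t) - 1 / (1 + t) * t = 0 := by field_simp; ring
    rw [h7, h8, one_smul, zero_smul, add_zero]
  have hvec : ∀ x ∈ hypersimplex d n, h + π (x - h) = x := by
    intro x hx
    rw [hπ, sumZeroProj_of_sum_eq_zero h (by simp [Finset.sum_sub_distrib, hs, hx.2])]
    abel
  have hDx : ∀ i j x, D i j (x - h) = D i j x := fun i j x => by rw [map_sub, hDh, sub_zero]
  let W := vectorSpan ℝ (hypersimplexVertices d n)
  have hWsum : ∀ v ∈ W, ∑ e, v e = 0 := by
    intro v hv
    have h1 : W ≤ LinearMap.ker (∑ e, LinearMap.proj e : (Fin n → ℝ) →ₗ[ℝ] ℝ) := by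
      refine Submodule.span_le.2 ?_
      rintro _ ⟨x, hx, y, hy, rfl⟩
      simp [Finset.sum_sub_distrib, hx.1.2, hy.1.2]
    have h2 := h1 hv
    simpa using h2
  have hMk : M.ncard = k := by
    have := hS.card_maximal
    rw [Set.ncard_def, this]
    rfl
  have hιk : Fintype.card ι ≤ k := by
    rw [← hMk, ← Nat.card_eq_fintype_card]
    exact Set.ncard_le_ncard (s := {C | C ∈ M ∧ (interior (K C)).Nonempty}) (fun C hC => hC.1) hMfin
  -- The kernel of `Φ` lies in the span of the common cell, so its rank is at least `k - 1`. It is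
  -- at most `Fintype.card ι - 1 ≤ k - 1`; equality gives both the count and surjectivity.
  have hrank : ∀ i, k ≤ Fintype.card ι ∧
      ∀ r : ι → ℝ, ∃ v, ∀ j, j ≠ i → D i j v = r j := by
    intro i
    let Φ : W →ₗ[ℝ] ({j // j ≠ i} → ℝ) := LinearMap.pi fun j => (D i j).comp W.subtype
    have hker : Module.finrank ℝ (LinearMap.ker Φ) ≤ Module.finrank ℝ (vectorSpan ℝ H) := by
      rw [← Submodule.finrank_map_subtype_eq]
      refine Submodule.finrank_mono ?_
      rintro _ ⟨⟨v, hvW⟩, hv, rfl⟩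
      have hv' : ∀ j, D i j v = 0 := by
        intro j
        by_cases hj : j = i
        · rw [hj, hDself]
        · exact congrFun (LinearMap.mem_ker.1 hv) ⟨j, hj⟩
      obtain ⟨t, ht, h1, -⟩ := hsmall v
      have h2 := hcore i (t • v) (fun j => by rw [map_smul, hv' j, smul_zero]) h1
      have h3 := vsub_mem_vectorSpan ℝ h2 hhH
      rw [← direction_affineSpan, affineSpan_convexHull, direction_affineSpan] at h3
      rw [vsub_eq_sub, add_sub_cancel_left, map_smul, hπ,
        sumZeroProj_of_sum_eq_zero h (hWsum v hvW)] at h3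
      exact (Submodule.smul_mem_iff _ ht.ne').1 h3
    have h1 := LinearMap.finrank_range_add_finrank_ker Φ
    have h2 := hH.codim
    have h3 : Module.finrank ℝ ({j // j ≠ i} → ℝ) = Fintype.card ι - 1 := by
      rw [Module.finrank_fintype_fun_eq_card, Fintype.card_subtype_compl, Fintype.card_subtype_eq]
    have h4 := Submodule.finrank_le (LinearMap.range Φ)
    have h5 : 0 < Fintype.card ι := Fintype.card_pos_iff.2 ⟨i⟩
    have h6 : Module.finrank ℝ W = Module.finrank ℝ (vectorSpan ℝ (hypersimplexVertices d n)) := rfl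
    refine ⟨by omega, fun r => ?_⟩
    have h7 : LinearMap.range Φ = ⊤ := Submodule.eq_top_of_finrank_eq (by omega)
    obtain ⟨v, hv⟩ := LinearMap.range_eq_top.1 h7 fun j => r j
    exact ⟨v, fun j hj => congrFun hv ⟨j, hj⟩⟩
  obtain ⟨i0, -⟩ := hcover 0
  refine ⟨ι, inferInstance, D, h, le_antisymm hιk (hrank i0).1,
    ⟨⟨hanti, hcover, fun i => (hrank i).2⟩, fun e => (hbd e).1, fun e => (hbd e).2, hs, hDh, ?_⟩, ?_⟩
  · intro i x hx hxD
    have h1 : x - h ∈ K i.1 := (hD i _).2 ⟨by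
      show h + π (x - h) ∈ hypersimplex d n
      rwa [hvec x hx], fun j => by rw [hDx]; exact hxD j⟩
    have h2 : h + π (x - h) ∈ convexHull ℝ i.1 := h1
    rw [hvec x hx] at h2
    refine convexHull_mono (fun y hy => ?_) h2
    have hyA := hsub.subset _ (hMS _ i.2.1) hy
    refine ⟨hyA, fun j => ?_⟩
    have h3 : y - h ∈ K i.1 := by
      show h + π (y - h) ∈ convexHull ℝ i.1
      rw [hvec y hyA.1]
      exact subset_convexHull ℝ _ hy
    have h4 := ((hD i _).1 h3).2 j
    rwa [hDx] at h4
  · ext x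
    constructor
    · intro hx
      have hxP := hcellP H hH.mem hx
      have hle : ∀ i j, 0 ≤ D i j x := by
        intro i j
        have h3 : x - h ∈ K i.1 := by
          show h + π (x - h) ∈ convexHull ℝ i.1
          rw [hvec x hxP]
          exact hHC _ i.2.1 hx
        have h4 := ((hD i _).1 h3).2 j
        rwa [hDx] at h4
      refine ⟨hxP, fun i j => ?_⟩
      have h1 := hle i j
      have h2 := hle j i
      rw [hanti] at h2
      linarith
    · rintro ⟨hxP, hx⟩
      rw [← hvec x hxP]
      refine hcore i0 _ (fun j => by rw [hDx]; exact hx i0 j) ?_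
      show h + π (x - h) ∈ hypersimplex d n
      rwa [hvec x hxP]

end SplitFan

/-! ### Exchange relations in the fan of a split -/

section FanExchange

variable {d n : ℕ} {ι : Type*} {D : ι → ι → (Fin n → ℝ) →ₗ[ℝ] ℝ} {h : Fin n → ℝ}

namespace IsHypersimplexFan

/-- The vertices of the hypersimplex that lie below a common `d + 1`-set lie in a common cone. -/
theorem exists_cone_of_card (F : IsHypersimplexFan d n D h) {T : Finset (Fin n)}
    (hT : T.card = d + 1) :
    ∃ l, ∀ c ∈ T, ∀ m, 0 ≤ D l m ((fun e => if e ∈ T then 1 else 0) - Pi.single c 1) := by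
  classical
  set u : Fin n → ℝ := fun e => if e ∈ T then 1 else 0 with hu
  have hus : ∑ e, u e = d + 1 := by
    simp [hu, hT]
  -- `b` is the barycenter of the `d + 1` vertices below `T`. The functional `φ` below is at least
  -- one on every vertex of the hypersimplex except `u - Pi.single c 1`, but less than one at `b`;
  -- so that vertex must occur in the cone of `b`.
  set b : Fin n → ℝ := ((d : ℝ) / (d + 1)) • u with hb
  have hd1 : (0 : ℝ) < d + 1 := by positivity
  have hbP : b ∈ hypersimplex d n := by
    refine ⟨fun e => ?_, ?_⟩
    · simp only [hb, Pi.smul_apply, smul_eq_mul, hu]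
      split_ifs
      · rw [mul_one]
        exact ⟨by positivity, (div_le_one hd1).2 (by linarith)⟩
      · simp
    · simp only [hb, Pi.smul_apply, smul_eq_mul, ← Finset.mul_sum, hus]
      field_simp
  obtain ⟨l, hl⟩ := F.fan.cover b
  refine ⟨l, fun c hc => ?_⟩
  by_contra hcon
  have hmem := F.gen l b hbP hl
  let φ : (Fin n → ℝ) →ₗ[ℝ] ℝ := (LinearMap.proj c : (Fin n → ℝ) →ₗ[ℝ] ℝ) +
    ∑ e ∈ Tᶜ, (LinearMap.proj e : (Fin n → ℝ) →ₗ[ℝ] ℝ)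
  have hφ : ∀ y : Fin n → ℝ, φ y = y c + ∑ e ∈ Tᶜ, y e := fun y => by simp [φ]
  have hφb : φ b = d / (d + 1) := by
    rw [hφ, Finset.sum_eq_zero fun e he => ?_]
    · simp [hb, hu, hc]
    · rw [Finset.mem_compl] at he
      simp [hb, hu, he]
  have hle : convexHull ℝ {y | y ∈ hypersimplexVertices d n ∧ ∀ j, 0 ≤ D l j y} ⊆
      {y | 1 ≤ φ y} := by
    refine convexHull_min ?_ (convex_halfSpace_ge φ.isLinear 1)
    rintro y ⟨hy, hyD⟩
    obtain ⟨h01, hys⟩ := mem_hypersimplexVertices_iff.1 hy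
    have hnn : ∀ e, 0 ≤ y e := fun e => (hy.1.1 e).1
    have hle1 : ∀ e, y e ≤ 1 := fun e => (hy.1.1 e).2
    show 1 ≤ φ y
    rw [hφ]
    by_contra! hlt
    have hs0 : 0 ≤ ∑ e ∈ Tᶜ, y e := Finset.sum_nonneg fun e _ => hnn e
    have hyc : y c = 0 := by
      rcases h01 c with h0 | h1
      · exact h0
      · linarith
    have hoff : ∀ e, e ∉ T → y e = 0 := by
      intro e he
      rcases h01 e with h0 | h1
      · exact h0
      · have := Finset.single_le_sum (f := y) (fun e _ => hnn e) (Finset.mem_compl.2 he)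
        linarith [hnn c]
    have hTs : ∑ e ∈ T.erase c, (1 - y e) = 0 := by
      have h1 : ∑ e ∈ T, y e = d := by
        rw [← hys]
        exact Finset.sum_subset (Finset.subset_univ _) fun e _ he => hoff e he
      have h2 := Finset.add_sum_erase T y hc
      rw [h1, hyc] at h2
      rw [Finset.sum_sub_distrib]
      simp only [Finset.sum_const, Finset.card_erase_of_mem hc, hT, nsmul_eq_mul, mul_one]
      push_cast [Nat.add_sub_cancel]
      linarith
    rw [Finset.sum_eq_zero_iff_of_nonneg fun e _ => sub_nonneg.2 (hle1 e)] at hTs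
    apply hcon
    have hyu : u - Pi.single c 1 = y := by
      funext e
      by_cases hec : e = c
      · subst hec
        simp [hu, hc, hyc]
      · by_cases heT : e ∈ T
        · have := hTs e (Finset.mem_erase.2 ⟨hec, heT⟩)
          simp only [hu, Pi.sub_apply, heT, if_true, Pi.single_eq_of_ne hec]
          linarith
        · simp [hu, heT, hec, hoff e heT]
    rw [hyu]
    exact hyD
  have h1 : 1 ≤ φ b := hle hmem
  rw [hφb, le_div_iff₀ hd1] at h1
  linarith

/-- A vertex of a cone stays in the cone when one of its elements is replaced by an element whose
unit vector lies in the cone. -/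
theorem exchange_mem (F : IsHypersimplexFan d n D h) {i : ι} {x : Fin n → ℝ}
    (hx : x ∈ hypersimplexVertices d n) (hxD : ∀ m, 0 ≤ D i m x) {e c : Fin n}
    (he : ∀ m, 0 ≤ D i m (Pi.single e 1)) (hxe : x e = 0) (hxc : x c = 1) (m : ι) :
    0 ≤ D i m (x + Pi.single e 1 - Pi.single c 1) := by
  classical
  obtain ⟨h01, hxs⟩ := mem_hypersimplexVertices_iff.1 hx
  let X : Finset (Fin n) := Finset.univ.filter fun b => x b = 1
  have hxX : ∀ b, x b = if b ∈ X then 1 else 0 := by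
    intro b
    by_cases hb : x b = 1
    · simp [X, hb]
    · simp [X, (h01 b).resolve_right hb]
  have hXcard : X.card = d := by
    have h1 : (X.card : ℝ) = d := by
      rw [← hxs, Finset.sum_congr rfl fun b _ => hxX b]
      simp
    exact_mod_cast h1
  have heX : e ∉ X := by simp [X, hxe]
  have hcX : c ∈ X := by simp [X, hxc]
  obtain ⟨l, hl⟩ := F.exists_cone_of_card (T := insert e X)
    (by rw [Finset.card_insert_of_notMem heX, hXcard])
  have hu : (fun b => if b ∈ insert e X then 1 else 0 : Fin n → ℝ) = x + Pi.single e 1 := by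
    funext b
    rw [Pi.add_apply, hxX b]
    by_cases hbe : b = e
    · subst hbe
      simp [heX]
    · simp [hbe]
  rw [hu] at hl
  -- Taking the removed element to be `e` shows that `x` lies in cone `l` as well as in cone `i`.
  have h1 : D l i x = 0 := by
    have h2 := hl e (Finset.mem_insert_self _ _) i
    rw [add_sub_cancel_right] at h2
    have h3 := hxD l
    rw [F.fan.anti] at h3
    linarith
  -- The sum equals `X.card * D l i (Pi.single e 1)`, as `D l i x = 0`. Its terms are nonnegative,
  -- so all vanish, and `facet` carries the vertices back to cone `i`.
  have h2 : ∑ b ∈ X, D l i (x + Pi.single e 1 - Pi.single b 1) ≤ 0 := by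
    have h3 : ∑ b ∈ X, D l i (Pi.single b 1) = D l i x := by
      rw [← map_sum]
      congr 1
      funext a
      rw [hxX a, Finset.sum_apply]
      simp only [Pi.single_apply, Finset.sum_ite_eq]
    have h4 := he l
    rw [F.fan.anti] at h4
    simp only [map_sub, map_add, h1, zero_add, Finset.sum_sub_distrib, h3, Finset.sum_const,
      nsmul_eq_mul]
    have : (0 : ℝ) ≤ X.card := Nat.cast_nonneg _
    nlinarith
  have h3 : ∀ b ∈ X, 0 ≤ D l i (x + Pi.single e 1 - Pi.single b 1) := fun b hb =>
    hl b (Finset.mem_insert_of_mem hb) i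
  have h4 := (Finset.sum_eq_zero_iff_of_nonneg h3).1
    (le_antisymm h2 (Finset.sum_nonneg h3)) c hcX
  exact F.fan.facet h4 (hl c (Finset.mem_insert_of_mem hcX)) m

/-- The part of a cone in the hypersimplex is invariant under the swap of two coordinates whose
unit vectors lie in the cone. -/
theorem swap_mem (F : IsHypersimplexFan d n D h) {i : ι} {e b : Fin n}
    (he : ∀ m, 0 ≤ D i m (Pi.single e 1)) (hb : ∀ m, 0 ≤ D i m (Pi.single b 1))
    {x : Fin n → ℝ} (hx : x ∈ hypersimplex d n) (hxD : ∀ m, 0 ≤ D i m x) (m : ι) :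
    0 ≤ D i m (x - (x e - x b) • (Pi.single e 1 - Pi.single b 1)) := by
  -- The swap is linear, so by `gen` it suffices to check vertices; there it does nothing or is a
  -- single exchange.
  let ψ : (Fin n → ℝ) →ₗ[ℝ] ℝ :=
    D i m - D i m (Pi.single e 1 - Pi.single b 1) •
      ((LinearMap.proj e : (Fin n → ℝ) →ₗ[ℝ] ℝ) - LinearMap.proj b)
  have hψ : ∀ y : Fin n → ℝ, ψ y = D i m (y - (y e - y b) • (Pi.single e 1 - Pi.single b 1)) := by
    intro y
    simp [ψ]
    ring
  rw [← hψ]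
  have hsub : convexHull ℝ {y | y ∈ hypersimplexVertices d n ∧ ∀ j, 0 ≤ D i j y} ⊆
      {y | 0 ≤ ψ y} := by
    refine convexHull_min ?_ (convex_halfSpace_ge ψ.isLinear 0)
    rintro y ⟨hy, hyD⟩
    show 0 ≤ ψ y
    rw [hψ]
    obtain ⟨h01, -⟩ := mem_hypersimplexVertices_iff.1 hy
    rcases h01 e with h0 | h0 <;> rcases h01 b with h1 | h1
    · simpa [h0, h1] using hyD m
    · have := F.exchange_mem hy hyD he h0 h1 m
      convert this using 2
      rw [h0, h1]
      module
    · have := F.exchange_mem hy hyD hb h1 h0 m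
      convert this using 2
      rw [h0, h1]
      module
    · simpa [h0, h1] using hyD m
  exact hsub (F.gen i x hx hxD)

/-- The infinitesimal form of `swap_mem`, for directions of coordinate sum zero: start at the
swapped point `p` of `h`, move along `v`, and swap back to land at `h` plus a multiple of the
swapped `v`. -/
theorem swap_nonneg (F : IsHypersimplexFan d n D h) {i : ι} {e b : Fin n} (heb : e ≠ b)
    (he : ∀ m, 0 ≤ D i m (Pi.single e 1)) (hb : ∀ m, 0 ≤ D i m (Pi.single b 1))
    {v : Fin n → ℝ} (hv : ∑ a, v a = 0) (hvD : ∀ m, 0 ≤ D i m v) (m : ι) :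
    0 ≤ D i m v - D i m (Pi.single e 1 - Pi.single b 1) * (v e - v b) := by
  classical
  set w : Fin n → ℝ := Pi.single e 1 - Pi.single b 1 with hw
  have hwe : w e = 1 := by simp [hw, heb]
  have hwb : w b = -1 := by simp [hw, heb.symm]
  have hws : ∑ a, w a = 0 := by simp [hw, Finset.sum_sub_distrib]
  set p : Fin n → ℝ := h - (h e - h b) • w with hp
  have hhP : h ∈ hypersimplex d n := ⟨fun a => ⟨(F.pos a).le, (F.lt_one a).le⟩, F.sum_eq⟩
  have hpa : ∀ a, 0 < p a ∧ p a < 1 := by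
    intro a
    by_cases hae : a = e
    · subst hae
      have : p a = h b := by simp [hp, hwe]
      rw [this]
      exact ⟨F.pos b, F.lt_one b⟩
    · by_cases hab : a = b
      · subst hab
        have : p a = h e := by simp [hp, hwb]
        rw [this]
        exact ⟨F.pos e, F.lt_one e⟩
      · have : p a = h a := by simp [hp, hw, hae, hab]
        rw [this]
        exact ⟨F.pos a, F.lt_one a⟩
  have hpD : ∀ j, 0 ≤ D i j p := F.swap_mem he hb hhP fun j => (F.apply_eq_zero i j).ge
  have hps : ∑ a, p a = d := by
    simp [hp, Finset.sum_sub_distrib, ← Finset.mul_sum, hws, F.sum_eq]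
  have hev : ∀ᶠ t : ℝ in nhds 0, ∀ a, 0 < (p + t • v) a ∧ (p + t • v) a < 1 := by
    have ho : IsOpen {x : Fin n → ℝ | ∀ a, 0 < x a ∧ x a < 1} := by
      simp only [Set.ofPred_forall]
      exact isOpen_iInter_of_finite fun e =>
        (isOpen_lt continuous_const (continuous_apply e)).inter
          (isOpen_lt (continuous_apply e) continuous_const)
    have hc : Continuous fun t : ℝ => p + t • v := by fun_prop
    exact hc.tendsto 0 (ho.mem_nhds (by simpa using hpa))
  obtain ⟨t, ht, h1, -⟩ := exists_pos_of_eventually_nhds_zero hev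
  have hmem : p + t • v ∈ hypersimplex d n := by
    refine ⟨fun a => ⟨(h1 a).1.le, (h1 a).2.le⟩, ?_⟩
    simp [Finset.sum_add_distrib, ← Finset.mul_sum, hv, hps]
  have h2 := F.swap_mem he hb hmem (fun j => by
    rw [map_add, map_smul]
    exact add_nonneg (hpD j) (mul_nonneg ht.le (hvD j))) m
  have h3 : p + t • v - ((p + t • v) e - (p + t • v) b) • w = h + t • (v - (v e - v b) • w) := by
    simp only [hp, Pi.add_apply, Pi.sub_apply, Pi.smul_apply, smul_eq_mul, hwe, hwb]
    module
  rw [h3, map_add, F.apply_eq_zero, zero_add, map_smul, smul_eq_mul, map_sub, map_smul,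
    smul_eq_mul] at h2
  have h4 := nonneg_of_mul_nonneg_right h2 ht
  linarith

variable [Fintype ι]

/-- If the unit vectors of two coordinates lie in a common cone, then either all functionals of
the cone agree on them, or exactly two differ and these two determine the difference of the
coordinates. -/
theorem exists_labels (F : IsHypersimplexFan d n D h) (hd : d ≠ 0) {i : ι} {e b : Fin n}
    (heb : e ≠ b) (he : ∀ m, 0 ≤ D i m (Pi.single e 1)) (hb : ∀ m, 0 ≤ D i m (Pi.single b 1))
    (hne : ∃ m, D i m (Pi.single e 1) ≠ D i m (Pi.single b 1)) :
    ∃ (j l : ι) (p q : ℝ), j ≠ i ∧ l ≠ i ∧ j ≠ l ∧ p * q < 0 ∧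
      p * (D i j (Pi.single e 1) - D i j (Pi.single b 1)) = 1 ∧
      q * (D i l (Pi.single e 1) - D i l (Pi.single b 1)) = 1 ∧
      (∀ m, m ≠ j → m ≠ l → D i m (Pi.single e 1) = D i m (Pi.single b 1)) ∧
      ∀ v : Fin n → ℝ, v e - v b = p * D i j v + q * D i l v := by
  classical
  set w : Fin n → ℝ := Pi.single e 1 - Pi.single b 1 with hw
  have hwe : w e = 1 := by simp [hw, heb]
  have hwb : w b = -1 := by simp [hw, heb.symm]
  have hws : ∑ a, w a = 0 := by simp [hw, Finset.sum_sub_distrib]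
  set δ : ι → ℝ := fun m => D i m w with hδ
  have hδ' : ∀ m, D i m (Pi.single e 1) - D i m (Pi.single b 1) = δ m := fun m => by
    simp [hδ, hw]
  have hδi : δ i = 0 := F.fan.self i w
  have hd' : (d : ℝ) ≠ 0 := by exact_mod_cast hd
  have hπD : ∀ m v, D i m (sumZeroProj d h v) = D i m v := by
    intro m v
    simp [sumZeroProj_apply, F.apply_eq_zero]
  have hπs : ∀ v, ∑ a, sumZeroProj d h v a = 0 := sum_sumZeroProj hd F.sum_eq
  -- These are the rays of cone `i`, dual to the `D i m`. In this basis the swap has entries `(if m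
  -- = m' then 1 else 0) - δ m * p m'`, all nonnegative by `swap_nonneg`.
  have hex : ∀ m' : ι, ∃ v : Fin n → ℝ, ∑ a, v a = 0 ∧
      ∀ m, D i m v = if m = i then 0 else if m = m' then 1 else 0 := by
    intro m'
    obtain ⟨v, hv⟩ := F.fan.surj i fun m => if m = m' then 1 else 0
    refine ⟨sumZeroProj d h v, hπs v, fun m => ?_⟩
    rw [hπD]
    by_cases hm : m = i
    · subst hm
      rw [F.fan.self, if_pos rfl]
    · rw [hv m hm, if_neg hm]
  choose x hxs hxD using hex
  set p : ι → ℝ := fun m => x m e - x m b with hp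
  have hx0 : ∀ m' m, 0 ≤ D i m (x m') := by
    intro m' m
    rw [hxD]
    split_ifs <;> norm_num
  have hdiag : ∀ m, m ≠ i → δ m * p m ≤ 1 := by
    intro m hm
    have := F.swap_nonneg heb he hb (hxs m) (hx0 m) m
    rw [hxD, if_neg hm, if_pos rfl] at this
    linarith
  have hoff : ∀ m m', m ≠ i → m ≠ m' → δ m * p m' ≤ 0 := by
    intro m m' hm hmm
    have := F.swap_nonneg heb he hb (hxs m') (hx0 m') m
    rw [hxD, if_neg hm, if_neg hmm] at this
    linarith
  have hker : ∀ v : Fin n → ℝ, ∑ a, v a = 0 → (∀ m, D i m v = 0) → v e - v b = 0 := by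
    intro v hv hvD
    obtain ⟨m, hm⟩ := hne
    have hm' : δ m ≠ 0 := by
      rw [← hδ']
      exact sub_ne_zero.2 hm
    have h1 := F.swap_nonneg heb he hb hv (fun m => (hvD m).ge) m
    have h2 := F.swap_nonneg heb he hb (v := -v) (by simp [hv]) (fun m => by simp [hvD m]) m
    simp only [map_neg, hvD m, Pi.neg_apply] at h1 h2
    have h3 : δ m * (v e - v b) = 0 := by
      simp only [hδ, hw]
      linarith
    exact (mul_eq_zero.1 h3).resolve_left hm'
  have hexp : ∀ v : Fin n → ℝ, ∑ a, v a = 0 →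
      v e - v b = ∑ m ∈ Finset.univ.erase i, D i m v * p m := by
    intro v hv
    have h1 := hker (v - ∑ m ∈ Finset.univ.erase i, D i m v • x m) (by
      simp only [Pi.sub_apply, Finset.sum_apply, Pi.smul_apply, smul_eq_mul,
        Finset.sum_sub_distrib, hv]
      rw [Finset.sum_comm, Finset.sum_eq_zero fun m _ => ?_, sub_zero]
      rw [← Finset.mul_sum, hxs, mul_zero]) (by
      intro m
      simp only [map_sub, map_sum, map_smul, smul_eq_mul, hxD]
      by_cases hm : m = i
      · subst hm
        simp [F.fan.self]
      · simp [hm])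
    simp only [Pi.sub_apply, Finset.sum_apply, Pi.smul_apply, smul_eq_mul] at h1
    have h2 : ∑ m ∈ Finset.univ.erase i, D i m v * p m =
        ∑ m ∈ Finset.univ.erase i, D i m v * x m e - ∑ m ∈ Finset.univ.erase i, D i m v * x m b := by
      rw [← Finset.sum_sub_distrib]
      exact Finset.sum_congr rfl fun m _ => by simp only [hp]; ring
    rw [h2]
    linarith
  -- The swap is a reflection negating `w`, so the products `δ m * p m` sum to two. Each is at most
  -- one, so at least two are positive; the off-diagonal signs make all other `δ` and `p` vanish.
  have hsum : ∑ m ∈ Finset.univ.erase i, δ m * p m = 2 := by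
    rw [← hexp w hws, hwe, hwb]
    norm_num
  obtain ⟨j, hj, hjpos⟩ : ∃ j ∈ Finset.univ.erase i, 0 < δ j * p j := by
    by_contra! hcon
    have := Finset.sum_nonpos hcon
    linarith
  have hji := Finset.ne_of_mem_erase hj
  have hsum' := Finset.add_sum_erase _ (fun m => δ m * p m) hj
  obtain ⟨l, hl, hlpos⟩ : ∃ l ∈ (Finset.univ.erase i).erase j, 0 < δ l * p l := by
    by_contra! hcon
    have := Finset.sum_nonpos hcon
    have := hdiag j hji
    linarith
  have hlj := Finset.ne_of_mem_erase hl
  have hli := Finset.ne_of_mem_erase (Finset.mem_of_mem_erase hl)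
  have h1 : δ j * p l ≤ 0 := hoff j l hji hlj.symm
  have h2 : δ l * p j ≤ 0 := hoff l j hli hlj
  have hpj : p j ≠ 0 := right_ne_zero_of_mul hjpos.ne'
  have hpl : p l ≠ 0 := right_ne_zero_of_mul hlpos.ne'
  have hδj : δ j ≠ 0 := left_ne_zero_of_mul hjpos.ne'
  have hpq : p j * p l < 0 := by
    rcases lt_or_gt_of_ne hpj with h3 | h3 <;> rcases lt_or_gt_of_ne hpl with h4 | h4
    · nlinarith [mul_pos_of_neg_of_neg h3 h4]
    · exact mul_neg_of_neg_of_pos h3 h4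
    · exact mul_neg_of_pos_of_neg h3 h4
    · nlinarith [mul_pos h3 h4]
  have hrest : ∀ m, m ≠ j → m ≠ l → δ m = 0 := by
    intro m hmj hml
    by_cases hmi : m = i
    · rw [hmi, hδi]
    have h3 := hoff m j hmi hmj
    have h4 := hoff m l hmi hml
    by_contra h5
    have h6 : 0 ≤ δ m * p j * (δ m * p l) := mul_nonneg_of_nonpos_of_nonpos h3 h4
    have h7 : 0 < δ m ^ 2 := by positivity
    nlinarith
  have hprest : ∀ m ∈ (Finset.univ.erase i).erase j, m ≠ l → p m = 0 := by
    intro m hm hml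
    have hmj := Finset.ne_of_mem_erase hm
    have h3 := hoff j m hji hmj.symm
    have h4 := hoff l m hli hml.symm
    by_contra h5
    have h6 : 0 ≤ δ j * p m * (δ l * p m) := mul_nonneg_of_nonpos_of_nonpos h3 h4
    have h7 : 0 < p m ^ 2 := by positivity
    have h8 : δ j * δ l < 0 := by
      by_contra! h9
      nlinarith [mul_pos hjpos hlpos]
    nlinarith
  have hsplit : ∀ f : ι → ℝ, ∑ m ∈ Finset.univ.erase i, f m * p m = f j * p j + f l * p l := by
    intro f
    rw [← Finset.add_sum_erase _ (fun m => f m * p m) hj]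
    congr 1
    refine Finset.sum_eq_single_of_mem l hl fun m hm hml => ?_
    rw [hprest m hm hml, mul_zero]
  have hs2 := hsplit δ
  rw [hsum] at hs2
  have h3 := hdiag j hji
  have h4 := hdiag l hli
  -- The swap keeps `h` in the cone, while `δ j` and `δ l` have opposite signs. This equality
  -- extends the final formula from sum-zero vectors to all vectors.
  have hh0 : h e - h b = 0 := by
    have hall : ∀ m, 0 ≤ -δ m * (h e - h b) := by
      intro m
      have h5 := F.swap_mem he hb (x := h)
        ⟨fun a => ⟨(F.pos a).le, (F.lt_one a).le⟩, F.sum_eq⟩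
        (fun m => (F.apply_eq_zero i m).ge) m
      rw [map_sub, F.apply_eq_zero, map_smul, smul_eq_mul] at h5
      simp only [hδ, hw]
      linarith
    have h5 := hall j
    have h6 := hall l
    have h8 : δ j * δ l < 0 := by
      by_contra! h9
      nlinarith [mul_pos hjpos hlpos]
    by_contra h9
    have h10 : 0 ≤ (-δ j * (h e - h b)) * (-δ l * (h e - h b)) := mul_nonneg h5 h6
    have h7 : 0 < (h e - h b) ^ 2 := by positivity
    nlinarith
  refine ⟨j, l, p j, p l, hji, hli, hlj.symm, hpq, ?_, ?_, ?_, ?_⟩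
  · rw [hδ']; linarith
  · rw [hδ']; linarith
  · intro m hmj hml
    have := hrest m hmj hml
    rw [← hδ'] at this
    linarith
  · intro v
    have h5 := hexp _ (hπs v)
    simp only [hπD] at h5
    rw [hsplit fun m => D i m v] at h5
    have h6 : sumZeroProj d h v e - sumZeroProj d h v b = v e - v b := by
      have : h e = h b := by linarith
      simp [sumZeroProj_apply, this]
    rw [← h6, h5]
    ring

/-- The unit vectors take at most as many values under the functionals of the fan as there are
cones. -/
theorem card_le (F : IsHypersimplexFan d n D h) (hd : d ≠ 0) {Ys : Finset (Fin n)}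
    (hYs : ∀ e ∈ Ys, ∀ b ∈ Ys, e ≠ b →
      ∃ i j, D i j (Pi.single e 1) ≠ D i j (Pi.single b 1)) :
    Ys.card ≤ Fintype.card ι := by
  classical
  obtain ⟨g, hg⟩ := F.fan.exists_potential
  choose c hc hg using hg
  choose τ hτ using fun e : Fin n => F.fan.cover (Pi.single e 1)
  -- Slack of label `s` below the maximum, attained at `τ e`; a zero at `i` means that the unit
  -- vector lies in cone `i`.
  let a : Fin n → ι → ℝ := fun e s => g (τ e) (Pi.single e 1) - g s (Pi.single e 1)
  have ha : ∀ e s, 0 ≤ a e s := by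
    intro e s
    have := hτ e s
    rw [hg] at this
    exact nonneg_of_mul_nonneg_right this (hc _ _)
  have hDa : ∀ i j e, D i j (Pi.single e 1) = c i j * (a e j - a e i) := by
    intro i j e
    rw [hg]
    simp only [a]
    ring
  have hcone : ∀ e i, a e i = 0 → ∀ m, 0 ≤ D i m (Pi.single e 1) := by
    intro e i h0 m
    rw [hDa, h0, sub_zero]
    exact mul_nonneg (hc i m).le (ha e m)
  refine (ExchangeSystem.card_le (Ls := Finset.univ) ha ⟨?_, ?_⟩).trans_eq Finset.card_univ
  · intro e _
    exact ⟨τ e, Finset.mem_univ _, by simp [a]⟩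
  · intro e he b hb heb i _ hei hbi
    have hne : ∃ m, D i m (Pi.single e 1) ≠ D i m (Pi.single b 1) := by
      by_contra! hcon
      obtain ⟨i', j', h'⟩ := hYs e he b hb heb
      have hab : ∀ m, a e m = a b m := by
        intro m
        have := hcon m
        rw [hDa, hDa, hei, hbi, sub_zero, sub_zero] at this
        exact mul_left_cancel₀ (hc i m).ne' this
      apply h'
      rw [hDa, hDa, hab, hab]
    obtain ⟨j, l, p, q, hji, hli, hjl, hpq, hpj, hql, hrest, hall⟩ :=
      F.exists_labels hd heb (hcone e i hei) (hcone b i hbi) hne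
    have hcj := hc i j
    have hcl := hc i l
    rw [hDa, hDa, hei, hbi, sub_zero, sub_zero] at hpj hql
    have hp0 : p ≠ 0 := left_ne_zero_of_mul hpq.ne
    have hq0 : q ≠ 0 := right_ne_zero_of_mul hpq.ne
    set P := p * c i j with hP
    set Q := q * c i l with hQ
    have hP0 : P ≠ 0 := mul_ne_zero hp0 hcj.ne'
    have hPQ : P * Q < 0 := by
      have : P * Q = p * q * (c i j * c i l) := by rw [hP, hQ]; ring
      rw [this]
      exact mul_neg_of_neg_of_pos hpq (mul_pos hcj hcl)
    have hpj' : P * (a e j - a b j) = 1 := by rw [hP]; linarith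
    have hql' : Q * (a e l - a b l) = 1 := by rw [hQ]; linarith
    have hall' : ∀ u : Fin n, (Pi.single u 1 : Fin n → ℝ) e - (Pi.single u 1 : Fin n → ℝ) b =
        P * (a u j - a u i) + Q * (a u l - a u i) := by
      intro u
      rw [hall, hDa, hDa, hP, hQ]
      ring
    have hu_e := hall' e
    have hu_b := hall' b
    rw [hei, sub_zero, sub_zero, Pi.single_eq_same, Pi.single_eq_of_ne heb.symm] at hu_e
    rw [hbi, sub_zero, sub_zero, Pi.single_eq_same, Pi.single_eq_of_ne heb] at hu_b
    have hPc : ∀ y z : ℝ, P * y + Q * z = 0 → y = -Q / P * z := by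
      intro y z hyz
      field_simp
      linarith
    -- The ratio `-Q / P` comes from evaluating the formula for `v e - v b` at unit vectors: a third
    -- coordinate gives 0, `e` and `b` give 1 and -1.
    refine ⟨j, l, -Q / P, Finset.mem_univ _, Finset.mem_univ _, hji, hli, hjl, ?_, ?_, ?_, ?_, ?_, ?_⟩
    · have : -Q / P = -(P * Q) / P ^ 2 := by field_simp
      rw [this]
      have : 0 < P ^ 2 := by positivity
      exact div_pos (by linarith) this
    · intro s _ hsj hsl
      have := hrest s hsj hsl
      rw [hDa, hDa, hei, hbi, sub_zero, sub_zero] at this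
      exact mul_left_cancel₀ (hc i s).ne' this
    · exact hPc _ _ (by linarith)
    · exact hPc _ _ (by linarith)
    · intro h0
      rw [h0, sub_self, mul_zero] at hpj'
      norm_num at hpj'
    · intro u _ hue hub
      refine hPc _ _ ?_
      rw [← hall' u, Pi.single_eq_of_ne hue.symm, Pi.single_eq_of_ne hub.symm, sub_zero]

end IsHypersimplexFan

end FanExchange

/-! ### The common face of the fan -/

section CommonFace

theorem Finpartition.sum_parts_sum {α β : Type*} [Fintype α] [DecidableEq α] [AddCommMonoid β]
    (P : Finpartition (Finset.univ : Finset α)) (f : α → β) :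
    ∑ C ∈ P.parts, ∑ e ∈ C, f e = ∑ e, f e := by
  have h1 : (Finset.univ : Finset α) = P.parts.biUnion id := P.biUnion_parts.symm
  conv_rhs => rw [h1]
  rw [Finset.sum_biUnion]
  · rfl
  · exact P.disjoint

variable {d n : ℕ} {ι : Type*} [Fintype ι] {D : ι → ι → (Fin n → ℝ) →ₗ[ℝ] ℝ} {h : Fin n → ℝ}

/-- The common face of the fan is cut out by the coordinate sums over the classes of a partition
with as many parts as there are cones. -/
theorem IsHypersimplexFan.exists_finpartition (F : IsHypersimplexFan d n D h) (hd : d ≠ 0)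
    (hne : ∃ x ∈ hypersimplexVertices d n, ∀ i j, D i j x = 0) :
    ∃ (P : Finpartition (Finset.univ : Finset (Fin n))) (r : Finset (Fin n) → ℕ),
      P.parts.card = Fintype.card ι ∧ (∀ C ∈ P.parts, 0 < r C ∧ r C < C.card) ∧
      ∀ x : Fin n → ℝ, (∑ e, x e = d ∧ ∀ i j, D i j x = 0) ↔
        ∀ C ∈ P.parts, ∑ e ∈ C, x e = r C := by
  classical
  let z : Fin n → ι → ι → ℝ := fun e i j => D i j (Pi.single e 1)
  let P : Finpartition (Finset.univ : Finset (Fin n)) := Finpartition.ofSetoid (Setoid.ker z)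
  have hP : ∀ C ∈ P.parts, ∀ e ∈ C, ∀ b, b ∈ C ↔ z e = z b := by
    intro C hC e he b
    rw [← P.part_eq_of_mem hC he]
    exact Finpartition.mem_part_ofSetoid_iff_rel
  have hrep : ∀ C : {C // C ∈ P.parts}, ∃ e, e ∈ C.1 := fun C => P.nonempty_of_mem_parts C.2
  choose rep hrep using hrep
  have hcard : P.parts.card ≤ Fintype.card ι := by
    have hinj : Function.Injective rep := by
      intro C C' hCC
      exact Subtype.ext (P.eq_of_mem_parts C.2 C'.2 (hrep C) (hCC ▸ hrep C'))
    have h1 := F.card_le hd (Ys := Finset.univ.map ⟨rep, hinj⟩) (by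
      intro e he b hb heb
      simp only [Finset.mem_map, Finset.mem_univ, true_and, Function.Embedding.coeFn_mk] at he hb
      obtain ⟨C, rfl⟩ := he
      obtain ⟨C', rfl⟩ := hb
      by_contra! hcon
      have hz : z (rep C) = z (rep C') := by
        funext i j
        exact hcon i j
      have h2 := (hP C.1 C.2 _ (hrep C) (rep C')).2 hz
      exact heb (congrArg rep (Subtype.ext (P.eq_of_mem_parts C.2 C'.2 h2 (hrep C')))))
    rwa [Finset.card_map, Finset.card_univ, Fintype.card_coe] at h1
  let cs : (Fin n → ℝ) → {C // C ∈ P.parts} → ℝ := fun x C => ∑ e ∈ C.1, x e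
  have hsum : ∀ (x : Fin n → ℝ), ∑ C, cs x C = ∑ e, x e := by
    intro x
    rw [← P.sum_parts_sum, ← Finset.sum_coe_sort P.parts]
  have hexp : ∀ i j x, D i j x = ∑ C, cs x C * z (rep C) i j := by
    intro i j x
    have h1 : x = ∑ e, x e • (Pi.single e 1 : Fin n → ℝ) := by
      funext a
      simp [Finset.sum_apply, Pi.single_apply]
    have h2 : D i j x = ∑ e, x e * z e i j := by
      conv_lhs => rw [h1]
      simp [z]
    rw [h2, ← P.sum_parts_sum, ← Finset.sum_coe_sort P.parts]
    refine Finset.sum_congr rfl fun C _ => ?_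
    rw [Finset.sum_mul]
    refine Finset.sum_congr rfl fun e he => ?_
    rw [(hP C.1 C.2 _ (hrep C) e).1 he]
  obtain ⟨o, -⟩ := F.fan.cover 0
  -- The functionals at `o`, read on class sums. `Ψ` is onto dimension `Fintype.card ι - 1` and
  -- kills the nonzero vector `cs h`, so there are at least `Fintype.card ι` classes; with `hcard`
  -- the kernel is a line.
  let Ψ : ({C // C ∈ P.parts} → ℝ) →ₗ[ℝ] ({j // j ≠ o} → ℝ) :=
    LinearMap.pi fun j => ∑ C, (LinearMap.proj C).smulRight (z (rep C) o j)
  have hΨ : ∀ y j, Ψ y j = ∑ C, y C * z (rep C) o j := by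
    intro y j
    simp [Ψ]
  have hΨD : ∀ (x : Fin n → ℝ) (j : {j // j ≠ o}), Ψ (cs x) j = D o j x := fun x j => by
    rw [hΨ, hexp]
  have hrange : LinearMap.range Ψ = ⊤ := by
    rw [LinearMap.range_eq_top]
    intro y
    obtain ⟨v, hv⟩ := F.fan.surj o fun j => if hj : j ≠ o then y ⟨j, hj⟩ else 0
    refine ⟨cs v, ?_⟩
    funext j
    rw [hΨD, hv j j.2, dif_pos j.2]
  have hker : ∀ x : Fin n → ℝ, (∀ i j, D i j x = 0) → cs x ∈ LinearMap.ker Ψ := by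
    intro x hx
    rw [LinearMap.mem_ker]
    funext j
    rw [hΨD, hx]
    rfl
  have hw := hker h F.apply_eq_zero
  have hd' : (d : ℝ) ≠ 0 := by exact_mod_cast hd
  have hw0 : (⟨cs h, hw⟩ : LinearMap.ker Ψ) ≠ 0 := by
    intro h0
    have h1 : cs h = 0 := congrArg Subtype.val h0
    have h2 := hsum h
    rw [h1, F.sum_eq] at h2
    simp at h2
    exact hd' h2.symm
  have hpos : 0 < Module.finrank ℝ (LinearMap.ker Ψ) :=
    Module.finrank_pos_iff_exists_ne_zero.2 ⟨_, hw0⟩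
  have hrk := LinearMap.finrank_range_add_finrank_ker Ψ
  rw [hrange, finrank_top, Module.finrank_fintype_fun_eq_card, Module.finrank_fintype_fun_eq_card,
    Fintype.card_subtype_compl, Fintype.card_subtype_eq, Fintype.card_coe] at hrk
  have hιpos : 0 < Fintype.card ι := Fintype.card_pos_iff.2 ⟨o⟩
  have hker1 : Module.finrank ℝ (LinearMap.ker Ψ) = 1 := by omega
  have hPcard : P.parts.card = Fintype.card ι := by omega
  have hclass : ∀ x : Fin n → ℝ, ∑ e, x e = d → (∀ i j, D i j x = 0) → cs x = cs h := by
    intro x hxs hx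
    obtain ⟨c, hc⟩ := (finrank_eq_one_iff_of_nonzero' _ hw0).1 hker1 ⟨cs x, hker x hx⟩
    have h1 : c • cs h = cs x := congrArg Subtype.val hc
    have h2 : ∑ C, (c • cs h) C = c * d := by
      rw [← F.sum_eq, ← hsum h, Finset.mul_sum]
      rfl
    rw [h1, hsum, hxs] at h2
    have h3 : c = 1 := by
      field_simp at h2
      exact h2.symm
    rw [← h1, h3, one_smul]
  obtain ⟨x, hxA, hxD⟩ := hne
  obtain ⟨h01, hxs⟩ := mem_hypersimplexVertices_iff.1 hxA
  have hxh := hclass x hxs hxD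
  -- The 0/1 vertex `x` on the common face has the same class sums as `h`, which makes them natural
  -- numbers.
  let r : Finset (Fin n) → ℕ := fun C => (C.filter fun e => x e = 1).card
  have hr : ∀ C, ∑ e ∈ C, x e = r C := by
    intro C
    simp only [r, Finset.card_filter]
    push_cast
    refine Finset.sum_congr rfl fun e _ => ?_
    rcases h01 e with h1 | h1 <;> simp [h1]
  have hrh : ∀ C ∈ P.parts, ∑ e ∈ C, h e = r C := fun C hC => by
    rw [← hr C]
    exact (congrFun hxh ⟨C, hC⟩).symm
  refine ⟨P, r, hPcard, fun C hC => ?_, fun y => ⟨?_, fun hy => ?_⟩⟩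
  · have hCne := P.nonempty_of_mem_parts hC
    constructor
    · have : (0 : ℝ) < r C := by
        rw [← hrh C hC]
        exact Finset.sum_pos (fun e _ => F.pos e) hCne
      exact_mod_cast this
    · have : (r C : ℝ) < C.card := by
        rw [← hrh C hC]
        calc ∑ e ∈ C, h e < ∑ e ∈ C, (1 : ℝ) := Finset.sum_lt_sum_of_nonempty hCne fun e _ => F.lt_one e
          _ = C.card := by simp
      exact_mod_cast this
  · rintro ⟨hys, hyD⟩ C hC
    rw [← hrh C hC]
    exact congrFun (hclass y hys hyD) ⟨C, hC⟩
  · have hcs : cs y = cs h := by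
      funext C
      exact (hy C.1 C.2).trans (hrh C.1 C.2).symm
    refine ⟨?_, fun i j => ?_⟩
    · rw [← hsum y, hcs, hsum, F.sum_eq]
    · rw [hexp, hcs, ← hexp, F.apply_eq_zero]

end CommonFace

/-! ### Partition matroids and their separators -/

section PartitionMatroids

variable {α : Type*} [Fintype α] [DecidableEq α]

/-- `B` meets every part `C` of `P` in exactly `r C` elements. -/
def IsPartitionBase (P : Finpartition (Finset.univ : Finset α)) (r : Finset α → ℕ) (B : Set α) :
    Prop :=
  ∀ C ∈ P.parts, (B ∩ (C : Set α)).ncard = r C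

variable {P : Finpartition (Finset.univ : Finset α)} {r : Finset α → ℕ}

theorem exists_isPartitionBase (hr : ∀ C ∈ P.parts, r C ≤ C.card) {C : Finset α}
    (hC : C ∈ P.parts) {t : Finset α} (htC : t ⊆ C) (ht : t.card = r C) :
    ∃ B, IsPartitionBase P r B ∧ B ∩ (C : Set α) = t := by
  have hex : ∀ D, ∃ u : Finset α, D ∈ P.parts → u ⊆ D ∧ u.card = r D := by
    intro D
    by_cases hD : D ∈ P.parts
    · obtain ⟨u, h1, h2⟩ := Finset.exists_subset_card_eq (hr D hD)
      exact ⟨u, fun _ => ⟨h1, h2⟩⟩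
    · exact ⟨∅, fun h => absurd h hD⟩
  choose u hu using hex
  let v : Finset α → Finset α := fun D => if D = C then t else u D
  have hv : ∀ D ∈ P.parts, v D ⊆ D ∧ (v D).card = r D := by
    intro D hD
    by_cases hDC : D = C
    · subst hDC
      simp only [v, if_true]
      exact ⟨htC, ht⟩
    · simp only [v, if_neg hDC]
      exact hu D hD
  let B : Set α := {e | e ∈ v (P.part e)}
  have hB : ∀ D ∈ P.parts, B ∩ (D : Set α) = v D := by
    intro D hD
    ext e
    simp only [B, Set.mem_inter_iff, Set.mem_ofPred_eq, Finset.mem_coe]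
    constructor
    · rintro ⟨h1, h2⟩
      rwa [P.part_eq_of_mem hD h2] at h1
    · intro h1
      have h2 := (hv D hD).1 h1
      rw [P.part_eq_of_mem hD h2]
      exact ⟨h1, h2⟩
  refine ⟨B, fun D hD => ?_, ?_⟩
  · rw [hB D hD, Set.ncard_coe_finset, (hv D hD).2]
  · rw [hB C hC]
    simp [v]

theorem IsPartitionBase.exchange {B : Set α} (hB : IsPartitionBase P r B) {C : Finset α}
    (hC : C ∈ P.parts) {a b : α} (ha : a ∈ B) (haC : a ∈ C) (hb : b ∉ B) (hbC : b ∈ C) :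
    IsPartitionBase P r (insert b (B \ {a})) := by
  intro D hD
  by_cases hDC : D = C
  · subst hDC
    have h1 : insert b (B \ {a}) ∩ (D : Set α) = insert b ((B ∩ D) \ {a}) := by
      ext x
      simp only [Set.mem_inter_iff, Set.mem_insert_iff, Set.mem_sdiff, Set.mem_singleton_iff,
        Finset.mem_coe]
      constructor
      · rintro ⟨rfl | h, h'⟩
        · exact Or.inl rfl
        · exact Or.inr ⟨⟨h.1, h'⟩, h.2⟩
      · rintro (rfl | h)
        · exact ⟨Or.inl rfl, hbC⟩
        · exact ⟨Or.inr ⟨h.1.1, h.2⟩, h.1.2⟩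
    have h2 : b ∉ B ∩ (D : Set α) := fun h => hb h.1
    have h3 : a ∈ B ∩ (D : Set α) := ⟨ha, haC⟩
    rw [h1, Set.ncard_exchange h2 h3, hB D hD]
  · have h1 : insert b (B \ {a}) ∩ (D : Set α) = B ∩ D := by
      ext x
      simp only [Set.mem_inter_iff, Set.mem_insert_iff, Set.mem_sdiff, Set.mem_singleton_iff,
        Finset.mem_coe]
      constructor
      · rintro ⟨rfl | h, h'⟩
        · exact absurd (P.eq_of_mem_parts hD hC h' hbC) hDC
        · exact ⟨h.1, h'⟩
      · rintro ⟨h, h'⟩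
        refine ⟨Or.inr ⟨h, ?_⟩, h'⟩
        rintro rfl
        exact hDC (P.eq_of_mem_parts hD hC h' haC)
    rw [h1, hB D hD]

theorem exists_isPartitionMatroid (hr : ∀ C ∈ P.parts, r C ≤ C.card) :
    ∃ M : Matroid α, M.E = Set.univ ∧ ∀ B, M.IsBase B ↔ IsPartitionBase P r B := by
  have hne : ∃ B, IsPartitionBase P r B := by
    by_cases hP : ∃ C, C ∈ P.parts
    · obtain ⟨C, hC⟩ := hP
      obtain ⟨t, h1, h2⟩ := Finset.exists_subset_card_eq (hr C hC)
      obtain ⟨B, hB, -⟩ := exists_isPartitionBase hr hC h1 h2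
      exact ⟨B, hB⟩
    · exact ⟨∅, fun C hC => absurd ⟨C, hC⟩ hP⟩
  refine ⟨Matroid.ofIsBaseOfFinite (E := Set.univ) Set.finite_univ (IsPartitionBase P r) hne ?_
    fun B _ => Set.subset_univ B, rfl, fun B => Iff.rfl⟩
  rintro B B' hB hB' a ⟨haB, haB'⟩
  have hC : P.part a ∈ P.parts := P.part_mem.2 (Finset.mem_univ a)
  have haC : a ∈ P.part a := P.mem_part (Finset.mem_univ a)
  have hex : ∃ b ∈ B' ∩ (P.part a : Set α), b ∉ B ∩ (P.part a : Set α) := by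
    by_contra! hcon
    have h1 := Set.eq_of_subset_of_ncard_le hcon (by rw [hB _ hC, hB' _ hC])
    have h2 : a ∈ B' ∩ (P.part a : Set α) := h1 ▸ ⟨haB, haC⟩
    exact haB' h2.1
  obtain ⟨b, hb, hb'⟩ := hex
  have hbB : b ∉ B := fun h => hb' ⟨h, hb.2⟩
  exact ⟨b, ⟨hb.1, hbB⟩, hB.exchange hC haB haC hbB hb.2⟩

variable {M : Matroid α}

theorem isBase_restrict_iff_of_parts (hE : M.E = Set.univ)
    (hM : ∀ B, M.IsBase B ↔ IsPartitionBase P r B) {S : Set α}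
    (hS : ∀ C ∈ P.parts, ∀ e ∈ C, e ∈ S → (C : Set α) ⊆ S) (I : Set α) :
    (M.restrict S).IsBase I ↔
      I ⊆ S ∧ ∀ C ∈ P.parts, (C : Set α) ⊆ S → (I ∩ (C : Set α)).ncard = r C := by
  have hSE : S ⊆ M.E := hE ▸ Set.subset_univ S
  rw [Matroid.isBase_restrict_iff hSE]
  have key : ∀ J, M.IsBasis J S → ∀ C ∈ P.parts, (C : Set α) ⊆ S →
      (J ∩ (C : Set α)).ncard = r C := by
    intro J hJ C hC hCS
    obtain ⟨B, hB, rfl⟩ := hJ.exists_isBase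
    rw [Set.inter_assoc, Set.inter_eq_self_of_subset_right hCS]
    exact (hM B).1 hB C hC
  refine ⟨fun hI => ⟨hI.subset, key I hI⟩, ?_⟩
  rintro ⟨hIS, hI⟩
  obtain ⟨B0, hB0⟩ := M.exists_isBase
  -- Completing `I` outside `S` by any base shows that it is independent. A basis of `S` containing
  -- `I` has the same count in each part, hence equals `I`.
  have hbase : M.IsBase (I ∪ B0 \ S) := by
    rw [hM]
    intro C hC
    by_cases hCS : (C : Set α) ⊆ S
    · rw [← hI C hC hCS]
      congr 1
      ext x
      simp only [Set.mem_inter_iff, Set.mem_union, Set.mem_sdiff, Finset.mem_coe]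
      constructor
      · rintro ⟨h1 | h1, h2⟩
        · exact ⟨h1, h2⟩
        · exact absurd (hCS h2) h1.2
      · exact fun h => ⟨Or.inl h.1, h.2⟩
    · rw [← (hM B0).1 hB0 C hC]
      congr 1
      ext x
      simp only [Set.mem_inter_iff, Set.mem_union, Set.mem_sdiff, Finset.mem_coe]
      constructor
      · rintro ⟨h1 | h1, h2⟩
        · exact absurd (hS C hC x h2 (hIS h1)) hCS
        · exact ⟨h1.1, h2⟩
      · exact fun h => ⟨Or.inr ⟨h.1, fun hx => hCS (hS C hC x h.2 hx)⟩, h.2⟩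
  obtain ⟨J, hJ, hIJ⟩ := (hbase.indep.subset Set.subset_union_left).subset_isBasis_of_subset hIS hSE
  have : I = J := by
    refine Set.Subset.antisymm hIJ fun e he => ?_
    have hC : P.part e ∈ P.parts := P.part_mem.2 (Finset.mem_univ e)
    have heC : e ∈ P.part e := P.mem_part (Finset.mem_univ e)
    have hCS := hS _ hC e heC (hJ.subset he)
    have h1 := Set.eq_of_subset_of_ncard_le
      (Set.inter_subset_inter_left (P.part e : Set α) hIJ)
      (by rw [key J hJ _ hC hCS, hI _ hC hCS])
    have h2 : e ∈ I ∩ (P.part e : Set α) := h1 ▸ ⟨he, heC⟩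
    exact h2.1
  rw [this]
  exact hJ

theorem isSeparator_of_parts (hE : M.E = Set.univ)
    (hM : ∀ B, M.IsBase B ↔ IsPartitionBase P r B) {S : Set α}
    (hS : ∀ C ∈ P.parts, ∀ e ∈ C, e ∈ S → (C : Set α) ⊆ S) : IsSeparator M S := by
  refine ⟨hE ▸ Set.subset_univ S, ?_⟩
  have hS' : ∀ C ∈ P.parts, ∀ e ∈ C, e ∈ M.E \ S → (C : Set α) ⊆ M.E \ S := by
    rintro C hC e heC ⟨-, heS⟩ b hbC
    exact ⟨hE ▸ Set.mem_univ b, fun hbS => heS (hS C hC b hbC hbS heC)⟩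
  have h1 := isBase_restrict_iff_of_parts hE hM hS
  have h2 := isBase_restrict_iff_of_parts hE hM hS'
  unfold matroidPolytope
  rw [← convexHull_add]
  congr 1
  ext x
  simp only [Set.mem_image, Set.mem_ofPred_eq, Set.mem_add]
  constructor
  · rintro ⟨B, hB, rfl⟩
    rw [hM] at hB
    refine ⟨_, ⟨B ∩ S, (h1 _).2 ⟨Set.inter_subset_right, fun C hC hCS => ?_⟩, rfl⟩,
      _, ⟨B ∩ (M.E \ S), (h2 _).2 ⟨Set.inter_subset_right, fun C hC hCS => ?_⟩, rfl⟩, ?_⟩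
    · rw [Set.inter_assoc, Set.inter_eq_self_of_subset_right hCS]
      exact hB C hC
    · rw [Set.inter_assoc, Set.inter_eq_self_of_subset_right hCS]
      exact hB C hC
    · funext e
      by_cases heB : e ∈ B <;> by_cases heS : e ∈ S <;> simp [Set.indicator, heB, heS, hE]
  · rintro ⟨_, ⟨I, hI, rfl⟩, _, ⟨J, hJ, rfl⟩, rfl⟩
    rw [h1] at hI
    rw [h2] at hJ
    refine ⟨I ∪ J, ?_, ?_⟩
    · rw [hM]
      intro C hC
      obtain ⟨e, he⟩ := P.nonempty_of_mem_parts hC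
      by_cases heS : e ∈ S
      · have hCS := hS C hC e he heS
        rw [← hI.2 C hC hCS]
        congr 1
        ext x
        simp only [Set.mem_inter_iff, Set.mem_union, Finset.mem_coe]
        constructor
        · rintro ⟨h3 | h3, h4⟩
          · exact ⟨h3, h4⟩
          · exact absurd (hCS h4) (hJ.1 h3).2
        · exact fun h => ⟨Or.inl h.1, h.2⟩
      · have hCS := hS' C hC e he ⟨hE ▸ Set.mem_univ e, heS⟩
        rw [← hJ.2 C hC hCS]
        congr 1
        ext x
        simp only [Set.mem_inter_iff, Set.mem_union, Finset.mem_coe]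
        constructor
        · rintro ⟨h3 | h3, h4⟩
          · exact absurd (hI.1 h3) (hCS h4).2
          · exact ⟨h3, h4⟩
        · exact fun h => ⟨Or.inr h.1, h.2⟩
    · have hdis : Disjoint I J := Set.disjoint_left.2 fun e h3 h4 => (hJ.1 h4).2 (hI.1 h3)
      exact Set.indicator_union_of_disjoint hdis _

/-- The sum of the coordinates in `S` is constant on the first summand of the product and zero on
the second, hence constant on the matroid polytope. -/
theorem IsSeparator.ncard_inter_eq {S : Set α} (hS : IsSeparator M S) {B B' : Set α}
    (hB : M.IsBase B) (hB' : M.IsBase B') : (B ∩ S).ncard = (B' ∩ S).ncard := by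
  classical
  let φ : (α → ℝ) →ₗ[ℝ] ℝ := ∑ e ∈ S.toFinset, (LinearMap.proj e : (α → ℝ) →ₗ[ℝ] ℝ)
  have hφ : ∀ I : Set α, φ (I.indicator fun _ => (1 : ℝ)) = (I ∩ S).ncard := by
    intro I
    have : φ (I.indicator fun _ => (1 : ℝ)) = ∑ e ∈ S.toFinset, I.indicator (fun _ => (1 : ℝ)) e := by
      simp [φ]
    rw [this, Set.ncard_eq_toFinset_card']
    simp only [Set.indicator_apply, Finset.sum_boole]
    congr 2
    ext e
    simp [and_comm]
  obtain ⟨B0, hB0⟩ := (M.restrict S).exists_isBase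
  have h1 : matroidPolytope (M.restrict S) ⊆ {x | φ x = B0.ncard} := by
    refine convexHull_min ?_ (convex_hyperplane φ.isLinear _)
    rintro _ ⟨I, hI, rfl⟩
    have hI' : (M.restrict S).IsBase I := hI
    show φ _ = _
    have hIS : I ⊆ S := hI'.subset_ground
    rw [hφ, Set.inter_eq_self_of_subset_left hIS, hI'.ncard_eq_ncard_of_isBase hB0]
  have h2 : matroidPolytope (M.restrict (M.E \ S)) ⊆ {x | φ x = 0} := by
    refine convexHull_min ?_ (convex_hyperplane φ.isLinear _)
    rintro _ ⟨I, hI, rfl⟩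
    have hI' : (M.restrict (M.E \ S)).IsBase I := hI
    show φ _ = _
    have h3 : I ∩ S = ∅ := by
      rw [← Set.disjoint_iff_inter_eq_empty, Set.disjoint_left]
      exact fun e he => (hI'.subset_ground he).2
    rw [hφ, h3, Set.ncard_empty, Nat.cast_zero]
  have h3 : ∀ I, M.IsBase I → (I ∩ S).ncard = B0.ncard := by
    intro I hI
    have h4 : I.indicator (fun _ => (1 : ℝ)) ∈ matroidPolytope M :=
      subset_convexHull ℝ _ ⟨I, hI, rfl⟩
    rw [hS.2] at h4
    obtain ⟨u, hu, v, hv, huv⟩ := h4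
    have h5 := hφ I
    rw [← huv, map_add, h1 hu, h2 hv, add_zero] at h5
    exact_mod_cast h5.symm
  rw [h3 B hB, h3 B' hB']

/-- `0 < r C` leaves room for `e`, and `r C < C.card` allows `b` to be left out. -/
theorem exists_isBase_mem_notMem (hr : ∀ C ∈ P.parts, 0 < r C ∧ r C < C.card)
    (hM : ∀ B, M.IsBase B ↔ IsPartitionBase P r B) {C : Finset α} (hC : C ∈ P.parts) {e b : α}
    (he : e ∈ C) (heb : e ≠ b) : ∃ B, M.IsBase B ∧ e ∈ B ∧ (b ∈ C → b ∉ B) := by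
  obtain ⟨t, h1, h2, h3⟩ := Finset.exists_subsuperset_card_eq (s := {e}) (t := C.erase b) (n := r C)
    (by simp [he, heb]) (by rw [Finset.card_singleton]; exact (hr C hC).1)
    ((Nat.le_sub_one_of_lt (hr C hC).2).trans Finset.pred_card_le_card_erase)
  obtain ⟨B, hB, hBt⟩ := exists_isPartitionBase (fun C hC => (hr C hC).2.le) hC
    (h2.trans (Finset.erase_subset _ _)) h3
  have hmem : ∀ x, x ∈ t ↔ x ∈ B ∧ x ∈ C := fun x => by
    rw [← Finset.mem_coe, ← hBt]
    rfl
  refine ⟨B, (hM B).2 hB, ((hmem e).1 (h1 (by simp))).1, fun hbC hbB => ?_⟩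
  exact Finset.notMem_erase b C (h2 ((hmem b).2 ⟨hbB, hbC⟩))

/-- Otherwise exchanging `e ∈ S` for `b ∉ S` within a part would produce a base with fewer elements
in `S`. -/
theorem IsSeparator.subset_of_mem (hr : ∀ C ∈ P.parts, 0 < r C ∧ r C < C.card)
    (hM : ∀ B, M.IsBase B ↔ IsPartitionBase P r B) {S : Set α} (hS : IsSeparator M S) :
    ∀ C ∈ P.parts, ∀ e ∈ C, e ∈ S → (C : Set α) ⊆ S := by
  intro C hC e he heS b hbC
  by_contra hbS
  have heb : e ≠ b := fun h => hbS (h ▸ heS)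
  obtain ⟨B, hB, heB, hbB⟩ := exists_isBase_mem_notMem hr hM hC he heb
  have hbB := hbB hbC
  have hB' := (hM _).2 (((hM B).1 hB).exchange hC heB he hbB hbC)
  have h1 := hS.ncard_inter_eq hB hB'
  have h2 : insert b (B \ {e}) ∩ S = (B ∩ S) \ {e} := by
    ext x
    simp only [Set.mem_inter_iff, Set.mem_insert_iff, Set.mem_sdiff, Set.mem_singleton_iff]
    constructor
    · rintro ⟨rfl | h, h'⟩
      · exact absurd h' hbS
      · exact ⟨⟨h.1, h'⟩, h.2⟩
    · exact fun h => ⟨Or.inr ⟨h.1.1, h.2⟩, h.1.2⟩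
  rw [h2] at h1
  have h3 := Set.ncard_sdiff_singleton_lt_of_mem (s := B ∩ S) ⟨heB, heS⟩
  omega

theorem isConnectedComponent_iff_of_parts (hE : M.E = Set.univ)
    (hr : ∀ C ∈ P.parts, 0 < r C ∧ r C < C.card)
    (hM : ∀ B, M.IsBase B ↔ IsPartitionBase P r B) (S : Set α) :
    IsConnectedComponent M S ↔ ∃ C ∈ P.parts, (C : Set α) = S := by
  have hpart : ∀ C ∈ P.parts, IsSeparator M (C : Set α) := by
    intro C hC
    refine isSeparator_of_parts hE hM fun C' hC' e he heC => ?_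
    rw [P.eq_of_mem_parts hC' hC he heC]
  constructor
  · rintro ⟨⟨⟨e, heS⟩, hS⟩, hmin⟩
    have hC : P.part e ∈ P.parts := P.part_mem.2 (Finset.mem_univ e)
    have heC : e ∈ P.part e := P.mem_part (Finset.mem_univ e)
    have hsub := hS.subset_of_mem hr hM _ hC e heC heS
    exact ⟨P.part e, hC, hsub.antisymm (hmin ⟨⟨e, heC⟩, hpart _ hC⟩ hsub)⟩
  · rintro ⟨C, hC, rfl⟩
    refine ⟨⟨P.nonempty_of_mem_parts hC, hpart C hC⟩, ?_⟩
    rintro T ⟨⟨e, heT⟩, hT⟩ hTC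
    exact hT.subset_of_mem hr hM C hC e (hTC heT) heT

end PartitionMatroids

/-! ### The common cell of a split -/

theorem sum_indicator_one_eq_ncard {α : Type*} (B : Set α) (C : Finset α) :
    ∑ e ∈ C, B.indicator (fun _ => (1 : ℝ)) e = (B ∩ (C : Set α)).ncard := by
  classical
  have h1 : B ∩ (C : Set α) = (C.filter (· ∈ B) : Finset α) := by
    ext e
    simp [and_comm]
  rw [h1, Set.ncard_coe_finset]
  simp [Set.indicator_apply]

theorem mainTheorem6 (d n k : ℕ) (hd : d ≤ n) (S : Set (Set (Fin n → ℝ)))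
    (hS : IsKSplit (hypersimplexVertices d n) k S)
    (H : Set (Fin n → ℝ)) (hH : IsCommonCell (hypersimplexVertices d n) k S H) :
    ∃ M : Matroid (Fin n),
      convexHull ℝ H = matroidPolytope M ∧
      IsPartitionMatroid M ∧
      (∀ e, ¬ M.IsLoop e) ∧
      (∀ e, ¬ M.IsColoop e) ∧
      {C | IsConnectedComponent M C}.encard = k := by
  obtain ⟨ι, _, D, h, hk, F, hHD⟩ := hS.exists_isHypersimplexFan hd hH
  have hd0 : d ≠ 0 := (hS.pos_and_lt hd).1.ne'
  have hHA := hS.coarsest.1.subset H hH.mem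
  have hHzero : ∀ x ∈ H, ∀ i j, D i j x = 0 := fun x hx => by
    have h1 := subset_convexHull ℝ H hx
    rw [hHD] at h1
    exact h1.2
  obtain ⟨x0, hx0⟩ := hS.coarsest.1.nonempty H hH.mem
  obtain ⟨P, r, hP, hr, hPr⟩ := F.exists_finpartition hd0 ⟨x0, hHA hx0, hHzero x0 hx0⟩
  obtain ⟨M, hE, hM⟩ := exists_isPartitionMatroid fun C hC => (hr C hC).2.le
  have hpart : ∀ e, P.part e ∈ P.parts ∧ e ∈ P.part e := fun e =>
    ⟨P.part_mem.2 (Finset.mem_univ e), P.mem_part (Finset.mem_univ e)⟩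
  have hother : ∀ e, ∃ b ∈ P.part e, b ≠ e := fun e => by
    obtain ⟨hC, heC⟩ := hpart e
    have h1 := hr _ hC
    exact Finset.exists_mem_ne (by omega) e
  refine ⟨M, ?_, ⟨hE, P, r, fun C hC => (hr C hC).2.le, hM⟩, fun e he => ?_, fun e he => ?_, ?_⟩
  -- The bases are exactly the hypersimplex vertices on the common face. `H` may be a proper subset
  -- of these vertices, so only the convex hulls are compared.
  · have hset : (fun B : Set (Fin n) => B.indicator fun _ => (1 : ℝ)) '' {B | M.IsBase B} =
        {x | x ∈ hypersimplexVertices d n ∧ ∀ i j, D i j x = 0} := by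
      ext x
      constructor
      · rintro ⟨B, hB, rfl⟩
        have hB' : M.IsBase B := hB
        obtain ⟨h1, h2⟩ := (hPr (B.indicator fun _ => (1 : ℝ))).2 fun C hC => by
          rw [sum_indicator_one_eq_ncard, (hM B).1 hB' C hC]
        refine ⟨mem_hypersimplexVertices_iff.2 ⟨fun e => ?_, h1⟩, h2⟩
        by_cases he : e ∈ B <;> simp [he]
      · rintro ⟨hxA, hxD⟩
        obtain ⟨h01, hxs⟩ := mem_hypersimplexVertices_iff.1 hxA
        have hx : ({e | x e = 1} : Set (Fin n)).indicator (fun _ => (1 : ℝ)) = x := by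
          funext e
          by_cases he : x e = 1
          · simp [Set.indicator, he]
          · simp [Set.indicator, (h01 e).resolve_right he]
        refine ⟨{e | x e = 1}, (hM _).2 fun C hC => ?_, hx⟩
        have h1 := (hPr x).1 ⟨hxs, hxD⟩ C hC
        rw [← hx, sum_indicator_one_eq_ncard] at h1
        exact_mod_cast h1
    unfold matroidPolytope
    rw [hset]
    refine Set.Subset.antisymm (convexHull_mono fun x hx => ⟨hHA hx, hHzero x hx⟩)
      (convexHull_min (fun x hx => ?_) (convex_convexHull ℝ H))
    rw [hHD]
    exact ⟨hx.1.1, hx.2⟩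
  · obtain ⟨b, -, hbe⟩ := hother e
    obtain ⟨B, hB, heB, -⟩ := exists_isBase_mem_notMem hr hM (hpart e).1 (hpart e).2 hbe.symm
    exact (Matroid.isLoop_iff_forall_mem_compl_isBase.1 he B hB).2 heB
  · obtain ⟨b, hb, hbe⟩ := hother e
    obtain ⟨B, hB, -, heB⟩ := exists_isBase_mem_notMem hr hM (hpart e).1 hb hbe
    exact heB (hpart e).2 (Matroid.isColoop_iff_forall_mem_isBase.1 he hB)
  · have h1 : {C | IsConnectedComponent M C} = (fun C : Finset (Fin n) => (C : Set (Fin n))) '' P.parts := by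
      ext C
      rw [Set.mem_ofPred_eq, isConnectedComponent_iff_of_parts hE hr hM]
      rfl
    rw [h1, Function.Injective.encard_image Finset.coe_injective, Set.encard_coe_eq_coe_finsetCard,
      hP, hk]
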